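/- Let $0\le c<R$. Let $K\subset\mathbb C$ be the circle of centre $c$ and radius $R$, and for $0\le t\le R-c$ let $L_t$ be the circle of centre $0$ and radius $t$ ($L_0$ is the point $0$, and $L_{R-c}$ is internally tangent to $K$, or equal to $K$ if $c=0$). Identify the set of pairs $(A,r)$, where $A\in K$ and $r$ is a line through $A$, with the torus $(\mathbb R/\mathbb Z)^2$: the pair $(x,y)$ stands for the point $A=c+Re^{2\pi i x}$ and the line $r$ through $A$ in the direction $\pm e^{i\pi y}$. Let $f$ be the Poncelet map $f(A,r)=(A',r')$, where $A'$ is the second intersection of $r$ with $K$ ($A'=A$ if $r$ is tangent to $K$) and $r'$ is the mirror image of $r$ in the line through $0$ and $A'$, so that $r,r'$ are the two tangents from $A'$ to the circle of centre $0$ which is tangent to $r$. In coordinates, $$f(x,y)=\bigl(x',\;3y-4x+Z(x')\bigr),\qquad x'=y-x+\tfrac12,\qquad Z(x)=-\tfrac{2}{\pi}\arctan\frac{c\sin 2\pi x}{R+c\cos 2\pi x}\pmod 1 .$$ Let $\Gamma_t$ be the set of the pairs $(A,r)$ such that $r$, oriented from $A$ to $A'$ (in one of its two orientations if $A=A'$),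 is tangent to $L_t$ and has $L_t$ on its left. Call a set $\Gamma\subset(\mathbb R/\mathbb Z)^2$ an invariant rotational circle of $f$ if it is the graph of a continuous map $\mathbb R/\mathbb Z\to\mathbb R/\mathbb Z$, $f(\Gamma)=\Gamma$ and $f|_\Gamma$ preserves the orientation of $\Gamma$; its rotation number $\rho(\Gamma)\in\mathbb R/\mathbb Z$ is the class modulo $1$ of $\lim_{k\to\infty}(g^k(x)-x)/k$, where $g$ is a lift to $\mathbb R$ of $f|_\Gamma$, read on $\mathbb R/\mathbb Z$ through the first coordinate. Then the following hold. (1) The sets $\Gamma_t$, $t\in[0,R-c]$, are pairwise disjoint invariant rotational circles of $f$. (2) There is a continuous, strictly monotone (in fact strictly decreasing) function $r:[0,R-c]\to\mathbb R$ with $\rho(\Gamma_t)=r(t)$ (mod $1$) for all $t$, $r(0)=\tfrac12$ and $r(R-c)=0$. (3) For every integer $q\ge 3$ there are exactly $e(q)/2$ circles among the $\Gamma_t$, $t\in[0,R-c]$, on which $f$ has a periodic orbit of period exactly $q$, where $e(q)$ is the number of natural numbers $n<q$ that are relatively prime to $q$. For $q=1$ and for $q=2$ there is exactly one such circle. -/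

import Mathlib

/-- The torus of pairs `(x, y)`, with `x, y ∈ ℝ/ℤ`.  Let `K` be the circle of centre `c` and
radius `R` in the complex plane.  The pair `(x, y)` stands for the flag `(A, r)`, where `A ∈ K` is
the point seen from the centre of `K` under the angle `θ = 2πx`, and `r` is the (unoriented) line
through `A` which makes the angle `φ = πy` (mod `π`) with the real axis. -/
abbrev FlagTorus : Type := UnitAddCircle × UnitAddCircle

/-- The point `c + R e^{2πix}` of the circle `K` of centre `c` and radius `R`. -/
noncomputable def boundaryPoint (c R : ℝ) (x : UnitAddCircle) : ℂ :=
  (c : ℂ) + (R : ℂ) * (AddCircle.toCircle x : ℂ)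

/-- The line `r` of the flag `p = (x, y)`: the line through `c + R e^{2πix}` in the directions
`± e^{iπy}`, the two square roots of `e^{2πiy}`. -/
noncomputable def flagLine (c R : ℝ) (p : FlagTorus) : Set ℂ :=
  {z | ∃ u : ℂ, u ^ 2 = (AddCircle.toCircle p.2 : ℂ) ∧
    ∃ s : ℝ, z = boundaryPoint c R p.1 + (s : ℂ) * u}

/-- The function `Z(x) = -B(2πx)/π` (mod `1`), with
`B(θ) = 2 arctan (c sin θ / (R + c cos θ))`. -/
noncomputable def ponceletZ (c R : ℝ) (x : UnitAddCircle) : UnitAddCircle :=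
  ((-(2 * Real.arctan (c * (AddCircle.toCircle x : ℂ).im
      / (R + c * (AddCircle.toCircle x : ℂ).re))) / Real.pi : ℝ) : UnitAddCircle)

/-- The Poncelet map `(A, r) ↦ (A', r')` of the torus: in the coordinates `(x, y)` it is
`(x, y) ↦ (x', 3y - 4x + Z(x'))`, with `x' = y - x + 1/2`.  Here `A'` is the second intersection
of `r` with `K` (see `flagLine_inter_sphere`), and `r'` is the second tangent from `A'` to the
circle with centre the origin which is tangent to `r`, that is, the mirror image of `r` in the
line through the origin and `A'` (see `flagLine_ponceletMap`). -/
noncomputable def ponceletMap (c R : ℝ) (p : FlagTorus) : FlagTorus :=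
  (p.2 - p.1 + ((1 / 2 : ℝ) : UnitAddCircle),
    3 • p.2 - 4 • p.1 + ponceletZ c R (p.2 - p.1 + ((1 / 2 : ℝ) : UnitAddCircle)))

theorem toCircle_half : (AddCircle.toCircle ((1 / 2 : ℝ) : UnitAddCircle) : ℂ) = -1 := by
  rw [AddCircle.toCircle_apply_mk, Circle.coe_exp]
  rw [← Complex.exp_pi_mul_I]
  congr 1
  push_cast
  ring

theorem toCircle_ponceletMap_fst (c R : ℝ) (p : FlagTorus) :
    (AddCircle.toCircle (ponceletMap c R p).1 : ℂ)
      = -((AddCircle.toCircle p.2 : ℂ) * (starRingEnd ℂ) (AddCircle.toCircle p.1 : ℂ)) := by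
  simp only [ponceletMap, AddCircle.toCircle_add, sub_eq_add_neg, AddCircle.toCircle_neg,
    Circle.coe_mul, toCircle_half, Circle.coe_inv_eq_conj]
  ring

theorem toCircle_mul_conj (x : UnitAddCircle) :
    (AddCircle.toCircle x : ℂ) * (starRingEnd ℂ) (AddCircle.toCircle x : ℂ) = 1 := by
  rw [Complex.mul_conj, Circle.normSq_coe]; simp

theorem mul_conj_of_sq_eq_toCircle (x : UnitAddCircle) (u : ℂ) (hu : u ^ 2 = (AddCircle.toCircle x : ℂ)) :
    u * (starRingEnd ℂ) u = 1 := by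
  have h : ‖u‖ ^ 2 = 1 := by rw [← norm_pow, hu]; exact Circle.norm_coe _
  rw [Complex.mul_conj, Complex.normSq_eq_norm_sq, h]; simp

/-- The line `r` meets the circle `K` in `A` and `A'`, and nowhere else. -/
theorem flagLine_inter_sphere (c R : ℝ) (hR : 0 < R) (p : FlagTorus) :
    flagLine c R p ∩ Metric.sphere (c : ℂ) R
      = {boundaryPoint c R p.1, boundaryPoint c R (ponceletMap c R p).1} := by
  have hsph : ∀ x : UnitAddCircle, boundaryPoint c R x ∈ Metric.sphere (c : ℂ) R := by
    intro x
    have h : ‖(AddCircle.toCircle x : ℂ)‖ = 1 := Circle.norm_coe _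
    simp only [boundaryPoint, Metric.mem_sphere, dist_eq_norm, add_sub_cancel_left, norm_mul, h,
      Complex.norm_real, Real.norm_eq_abs, abs_of_pos hR, mul_one]
  have hb := toCircle_ponceletMap_fst c R p
  have ha := toCircle_mul_conj p.1
  obtain ⟨u0, hu0⟩ := IsAlgClosed.exists_pow_nat_eq (AddCircle.toCircle p.2 : ℂ) two_pos
  -- the second point
  have key : ∀ u : ℂ, u ^ 2 = (AddCircle.toCircle p.2 : ℂ) →
      boundaryPoint c R (ponceletMap c R p).1 = boundaryPoint c R p.1 +
        ((-(2 * R * ((starRingEnd ℂ) (AddCircle.toCircle p.1 : ℂ) * u).re) : ℝ) : ℂ) * u := by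
    intro u hu
    have huu := mul_conj_of_sq_eq_toCircle p.2 u hu
    have hre : (((2 * ((starRingEnd ℂ) (AddCircle.toCircle p.1 : ℂ) * u).re : ℝ)) : ℂ)
        = (starRingEnd ℂ) (AddCircle.toCircle p.1 : ℂ) * u
          + (AddCircle.toCircle p.1 : ℂ) * (starRingEnd ℂ) u := by
      have := Complex.add_conj ((starRingEnd ℂ) (AddCircle.toCircle p.1 : ℂ) * u)
      rw [map_mul, Complex.conj_conj] at this
      rw [this]
    have h2 : ((-(2 * R * ((starRingEnd ℂ) (AddCircle.toCircle p.1 : ℂ) * u).re) : ℝ) : ℂ)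
        = -(R : ℂ) * ((starRingEnd ℂ) (AddCircle.toCircle p.1 : ℂ) * u
          + (AddCircle.toCircle p.1 : ℂ) * (starRingEnd ℂ) u) := by
      rw [← hre]; push_cast; ring
    rw [h2]
    simp only [boundaryPoint]
    rw [hb, ← hu]
    linear_combination (R : ℂ) * (AddCircle.toCircle p.1 : ℂ) * huu
  ext z
  simp only [Set.mem_inter_iff, Set.mem_insert_iff, Set.mem_singleton_iff]
  constructor
  · rintro ⟨⟨u, hu, s, rfl⟩, hz⟩
    have huu := mul_conj_of_sq_eq_toCircle p.2 u hu
    by_cases hs : s = 0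
    · left; simp [hs]
    right
    rw [key u hu]
    have hn : Complex.normSq ((R : ℂ) * (AddCircle.toCircle p.1 : ℂ) + (s : ℂ) * u) = R ^ 2 := by
      rw [Complex.normSq_eq_norm_sq]
      rw [Metric.mem_sphere, dist_eq_norm] at hz
      have h : boundaryPoint c R p.1 + (s : ℂ) * u - (c : ℂ)
          = (R : ℂ) * (AddCircle.toCircle p.1 : ℂ) + (s : ℂ) * u := by
        simp only [boundaryPoint]; ring
      rw [h] at hz
      rw [hz]
    have ha' : (AddCircle.toCircle p.1 : ℂ).re ^ 2 + (AddCircle.toCircle p.1 : ℂ).im ^ 2 = 1 := by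
      have := Circle.normSq_coe (AddCircle.toCircle p.1)
      rw [Complex.normSq_apply] at this
      linarith
    have hu' : u.re ^ 2 + u.im ^ 2 = 1 := by
      have := congrArg Complex.re huu
      rw [Complex.mul_conj, Complex.ofReal_re, Complex.normSq_apply] at this
      simp at this
      linarith
    rw [Complex.normSq_apply] at hn
    simp at hn
    have h0 : s * (s + 2 * R * ((AddCircle.toCircle p.1 : ℂ).re * u.re
        + (AddCircle.toCircle p.1 : ℂ).im * u.im)) = 0 := by
      linear_combination hn - R ^ 2 * ha' - s ^ 2 * hu'
    have h1 := (mul_eq_zero.mp h0).resolve_left hs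
    have h2 : s = -(2 * R * ((starRingEnd ℂ) (AddCircle.toCircle p.1 : ℂ) * u).re) := by
      rw [Complex.mul_re, Complex.conj_re, Complex.conj_im]
      linarith
    rw [← h2]
  · rintro (rfl | rfl)
    · exact ⟨⟨u0, hu0, 0, by simp⟩, hsph _⟩
    · exact ⟨⟨u0, hu0, _, key u0 hu0⟩, hsph _⟩

theorem toCircle_ponceletMap_snd (c R : ℝ) (hc : 0 ≤ c) (hcR : c < R) (p : FlagTorus) :
    boundaryPoint c R (ponceletMap c R p).1 ≠ 0 ∧
    (AddCircle.toCircle (ponceletMap c R p).2 : ℂ)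
      = (starRingEnd ℂ) (AddCircle.toCircle p.2 : ℂ)
        * (boundaryPoint c R (ponceletMap c R p).1
          / (starRingEnd ℂ) (boundaryPoint c R (ponceletMap c R p).1)) ^ 2 := by
  have ha := toCircle_mul_conj p.1
  have hw := toCircle_mul_conj p.2
  have hbw := toCircle_ponceletMap_fst c R p
  have hbb := toCircle_mul_conj (ponceletMap c R p).1
  have hsnd : (AddCircle.toCircle (ponceletMap c R p).2 : ℂ)
      = (AddCircle.toCircle p.2 : ℂ) ^ 3
        * (starRingEnd ℂ) (AddCircle.toCircle p.1 : ℂ) ^ 4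
        * (AddCircle.toCircle (ponceletZ c R (ponceletMap c R p).1) : ℂ) := by
    simp only [ponceletMap, AddCircle.toCircle_add, sub_eq_add_neg, AddCircle.toCircle_neg,
      AddCircle.toCircle_nsmul, Circle.coe_mul, Circle.coe_inv_eq_conj, Circle.coe_pow, map_pow]
  set x := (ponceletMap c R p).1 with hx
  set a := (AddCircle.toCircle p.1 : ℂ)
  set w := (AddCircle.toCircle p.2 : ℂ)
  set b := (AddCircle.toCircle x : ℂ) with hbdef
  have hre : |b.re| ≤ 1 := by
    have := Complex.abs_re_le_norm b
    exact this.trans_eq (Circle.norm_coe _)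
  have hpos : 0 < R + c * b.re := by
    have := neg_le_of_abs_le hre
    nlinarith
  -- the complex number with argument half of `B`
  have hD : (R : ℂ) + c * b ≠ 0 := by
    intro h
    have := congrArg Complex.re h
    simp at this
    linarith
  have hD' : (R : ℂ) + c * (starRingEnd ℂ) b ≠ 0 := by
    intro h
    have := congrArg Complex.re h
    simp at this
    linarith
  have hZ : (AddCircle.toCircle (ponceletZ c R x) : ℂ)
      = (((R : ℂ) + c * (starRingEnd ℂ) b) / ((R : ℂ) + c * b)) ^ 2 := by
    set τ := Real.arctan (c * b.im / (R + c * b.re)) with hτ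
    have h1 : (AddCircle.toCircle (ponceletZ c R x) : ℂ)
        = Complex.exp (-(4 * τ : ℝ) * Complex.I) := by
      rw [ponceletZ, AddCircle.toCircle_apply_mk, Circle.coe_exp]
      congr 1
      rw [← hbdef, ← hτ]
      have : (Real.pi : ℂ) ≠ 0 := by exact_mod_cast Real.pi_ne_zero
      push_cast
      field_simp
      ring
    have htan : Real.sin τ * (R + c * b.re) = Real.cos τ * (c * b.im) := by
      have h := Real.tan_arctan (c * b.im / (R + c * b.re))
      rw [← hτ, Real.tan_eq_sin_div_cos] at h
      have hcos : Real.cos τ ≠ 0 := (Real.cos_arctan_pos _).ne'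
      field_simp at h
      linarith
    have h2 : Complex.exp ((τ : ℂ) * Complex.I) * ((R : ℂ) + c * (starRingEnd ℂ) b)
        = Complex.exp (-(τ : ℂ) * Complex.I) * ((R : ℂ) + c * b) := by
      rw [Complex.exp_mul_I, Complex.exp_mul_I, Complex.cos_neg, Complex.sin_neg,
        ← Complex.ofReal_cos, ← Complex.ofReal_sin]
      apply Complex.ext
      · simp [-Complex.ofReal_cos, -Complex.ofReal_sin]
      · simp [-Complex.ofReal_cos, -Complex.ofReal_sin]
        linarith
    have h3 : ((R : ℂ) + c * (starRingEnd ℂ) b) / ((R : ℂ) + c * b)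
        = Complex.exp (-(2 * τ : ℝ) * Complex.I) := by
      rw [div_eq_iff hD]
      have h4 : Complex.exp (-(τ : ℂ) * Complex.I) * Complex.exp ((τ : ℂ) * Complex.I) = 1 := by
        rw [← Complex.exp_add]; simp
      have h5 : Complex.exp (-(2 * τ : ℝ) * Complex.I)
          = Complex.exp (-(τ : ℂ) * Complex.I) * Complex.exp (-(τ : ℂ) * Complex.I) := by
        rw [← Complex.exp_add]; congr 1; push_cast; ring
      rw [h5, mul_assoc, ← h2, ← mul_assoc, h4, one_mul]
    rw [h1, h3, ← Complex.exp_nat_mul]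
    congr 1
    push_cast
    ring
  have hA : boundaryPoint c R x = b * ((R : ℂ) + c * (starRingEnd ℂ) b) := by
    simp only [boundaryPoint, ← hbdef]
    linear_combination -(c : ℂ) * hbb
  have hA' : (starRingEnd ℂ) (boundaryPoint c R x) = (starRingEnd ℂ) b * ((R : ℂ) + c * b) := by
    rw [hA]; simp
  have hb0 : b ≠ 0 := left_ne_zero_of_mul_eq_one hbb
  have hb0' : (starRingEnd ℂ) b ≠ 0 := right_ne_zero_of_mul_eq_one hbb
  refine ⟨by rw [hA]; exact mul_ne_zero hb0 hD', ?_⟩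
  rw [hsnd, hZ, hA', hA]
  have hq : b / (starRingEnd ℂ) b = b ^ 2 := by
    rw [div_eq_iff hb0']
    linear_combination -b * hbb
  rw [mul_div_mul_comm, hq, mul_pow, ← mul_assoc]
  congr 1
  rw [hbw]
  linear_combination (-w ^ 3 * (starRingEnd ℂ) a ^ 4) * hw

/-- The line `r'` is the mirror image of `r` in the line through the origin and `A'`. -/
theorem flagLine_ponceletMap (c R : ℝ) (hc : 0 ≤ c) (hcR : c < R) (p : FlagTorus) :
    flagLine c R (ponceletMap c R p)
      = (fun z : ℂ => boundaryPoint c R (ponceletMap c R p).1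
          / (starRingEnd ℂ) (boundaryPoint c R (ponceletMap c R p).1) * (starRingEnd ℂ) z)
        '' flagLine c R p := by
  obtain ⟨hA0, hsnd⟩ := toCircle_ponceletMap_snd c R hc hcR p
  have hmem : boundaryPoint c R (ponceletMap c R p).1 ∈ flagLine c R p := by
    have h : boundaryPoint c R (ponceletMap c R p).1 ∈ flagLine c R p ∩ Metric.sphere (c : ℂ) R :=
      by rw [flagLine_inter_sphere c R (hc.trans_lt hcR) p]; simp
    exact h.1
  have hA0' : (starRingEnd ℂ) (boundaryPoint c R (ponceletMap c R p).1) ≠ 0 := by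
    simpa using hA0
  -- the line through `A'`, in any of its two directions
  have hline : ∀ u : ℂ, u ^ 2 = (AddCircle.toCircle p.2 : ℂ) → ∃ s₀ : ℝ,
      boundaryPoint c R (ponceletMap c R p).1 = boundaryPoint c R p.1 + (s₀ : ℂ) * u := by
    intro u hu
    obtain ⟨v, hv, s, hs⟩ := hmem
    rcases sq_eq_sq_iff_eq_or_eq_neg.mp (hv.trans hu.symm) with rfl | rfl
    · exact ⟨s, hs⟩
    · exact ⟨-s, by rw [hs]; push_cast; ring⟩
  set A := boundaryPoint c R (ponceletMap c R p).1 with hAdef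
  have hmm : A / (starRingEnd ℂ) A * ((starRingEnd ℂ) A / A) = 1 := by field_simp
  ext z
  constructor
  · rintro ⟨v, hv, s, rfl⟩
    have hu : (A / (starRingEnd ℂ) A * (starRingEnd ℂ) v) ^ 2
        = (AddCircle.toCircle p.2 : ℂ) := by
      rw [mul_pow, ← map_pow, hv, hsnd, map_mul, Complex.conj_conj, map_pow, map_div₀,
        Complex.conj_conj]
      linear_combination (AddCircle.toCircle p.2 : ℂ)
        * (A / (starRingEnd ℂ) A * ((starRingEnd ℂ) A / A) + 1) * hmm
    obtain ⟨s₀, hs₀⟩ := hline _ hu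
    refine ⟨A + (s : ℂ) * (A / (starRingEnd ℂ) A * (starRingEnd ℂ) v),
      ⟨_, hu, s₀ + s, by push_cast; linear_combination hs₀⟩, ?_⟩
    simp only [map_add, map_mul, map_div₀, Complex.conj_conj, Complex.conj_ofReal]
    rw [mul_add, div_mul_cancel₀ A hA0']
    linear_combination (s : ℂ) * v * hmm
  · rintro ⟨z, ⟨u, hu, s, rfl⟩, rfl⟩
    obtain ⟨s₀, hs₀⟩ := hline u hu
    refine ⟨A / (starRingEnd ℂ) A * (starRingEnd ℂ) u, ?_, s - s₀, ?_⟩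
    · rw [mul_pow, ← map_pow, hu, hsnd]; ring
    · have h1 : boundaryPoint c R p.1 = A - (s₀ : ℂ) * u := by rw [hs₀]; ring
      rw [h1, ← hAdef]
      simp only [map_add, map_sub, map_mul, Complex.conj_ofReal]
      rw [mul_add, mul_sub, div_mul_cancel₀ A hA0']
      push_cast
      ring

/-- The set `Γ_t` of the flags `(A, r)` whose line `r`, oriented from `A` to `A'`, is tangent to
the circle `L` of centre the origin and radius `t`, with `L` on the left of `r`.  The unit vector
`u` is the direction of `r` oriented from `A` to `A'` (if `A = A'`, both directions are admitted),
and `L` is tangent to `r` and on its left if and only if the origin is at the signed distance `t`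
to the left of `r`. -/
noncomputable def tangentFlags (c R t : ℝ) : Set FlagTorus :=
  {p | ∃ u : ℂ, u ^ 2 = (AddCircle.toCircle p.2 : ℂ) ∧
    (∃ s : ℝ, 0 ≤ s ∧
      boundaryPoint c R (ponceletMap c R p).1 = boundaryPoint c R p.1 + (s : ℂ) * u) ∧
    ((starRingEnd ℂ) u * (0 - boundaryPoint c R p.1)).im = t}

/-- `g` is a lift to `ℝ` of the circle map `h`, and `g` is continuous, strictly increasing and of
degree one.  A bijective continuous circle map has such a lift exactly if it is an
orientation-preserving homeomorphism. -/
structure IsOrientedLift (h : UnitAddCircle → UnitAddCircle) (g : CircleDeg1Lift) : Prop where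
  continuous : Continuous g
  strictMono : StrictMono g
  lifts : ∀ x : ℝ, h (x : UnitAddCircle) = ((g x : ℝ) : UnitAddCircle)

/-- The restriction of `f` to the graph of `φ`, read on the circle through the first
projection. -/
def graphMap (f : FlagTorus → FlagTorus) (φ : UnitAddCircle → UnitAddCircle) :
    UnitAddCircle → UnitAddCircle :=
  fun x => (f (x, φ x)).1

/-- `Γ` is an invariant rotational circle of `f`: the graph of a continuous map of the circle to
itself, with `f(Γ) = Γ`, and such that `f|Γ` preserves the orientation of `Γ`. -/
def IsInvariantRotationalCircle (f : FlagTorus → FlagTorus) (Γ : Set FlagTorus) : Prop :=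
  f '' Γ = Γ ∧ ∃ φ : UnitAddCircle → UnitAddCircle, Continuous φ ∧
    Γ = Set.range (fun x => (x, φ x)) ∧ ∃ g : CircleDeg1Lift, IsOrientedLift (graphMap f φ) g

/-- `ρ ∈ ℝ/ℤ` is the rotation number of `f|Γ`: `Γ` is the graph of a continuous map and `ρ` is
the class modulo `1` of the translation number `lim (gᵏ x - x)/k` of a lift `g` of `f|Γ`. -/
def HasRotationNumber (f : FlagTorus → FlagTorus) (Γ : Set FlagTorus) (ρ : UnitAddCircle) :
    Prop :=
  ∃ φ : UnitAddCircle → UnitAddCircle, Continuous φ ∧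
    Γ = Set.range (fun x => (x, φ x)) ∧ ∃ g : CircleDeg1Lift, IsOrientedLift (graphMap f φ) g ∧
      ρ = ((CircleDeg1Lift.translationNumber g : ℝ) : UnitAddCircle)

/-- The circles `Γ_t`, `t ∈ [0, R - c]`, on which the Poncelet map has a periodic orbit of period
exactly `q`. -/
def circlesWithPeriod (c R : ℝ) (q : ℕ) : Set (Set FlagTorus) :=
  {Γ | (∃ t ∈ Set.Icc 0 (R - c), Γ = tangentFlags c R t) ∧
    ∃ p ∈ Γ, Function.minimalPeriod (ponceletMap c R) p = q}

/-! At A = c + R e^{2πix} let γ be the clockwise angle from the direction towards c to that of the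
tangent to L_t with L_t on its left. The direction towards 0 splits it as γ = τ + β, where τ
(`centreAngle`) does not depend on t and β (`halfAperture`) is half the angle subtended by L_t. So
Γ_t is the graph of y = 2x - γ/π, and on it f acts by x ↦ x' = x + 1/2 - γ/π.

A chord makes equal angles with the radii at its two ends. At A' the same line is therefore the
other tangent, which gives γ(x) = β(x') - τ(x') (`tangentAngle_eq_of_chord`). Two things follow: the
reflected line is again the left tangent at A', so Γ_t is invariant; and x can be recovered from x',
so the lift `chordStep` is injective, hence increasing because it has degree one.

Differentiating the tangency equation gives dx'/dx = P(x')/P(x), where P is the length of the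
tangent from A to L_t (`hasDerivAt_chordStep`). For t < R - c this length is positive, dx/P is an
invariant measure, and the map is conjugate to a rotation (`exists_semiconj_translate`). Raising t
lowers the lift at every point. In general this only makes the translation number nonincreasing, but
the decrease is strict when one of the two lifts is conjugate to a translation.

The end values come from one orbit each: the real diameter for t = 0, the tangent to K at c - R for
t = R - c. Thus the rotation number runs bijectively through [0, 1/2], and period q occurs exactly
at the reduced fractions m/q in this interval. For q ≥ 3 the reflection m ↦ q - m shows that they
are half of all residues coprime to q. -/

/-! ### Translation numbers of families of lifts; conjugacies from densities. -/

theorem UnitAddCircle.coe_eq_coe_iff {a b : ℝ} :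
    (a : UnitAddCircle) = (b : UnitAddCircle) ↔ ∃ m : ℤ, a = b + m := by
  rw [← sub_eq_zero, ← AddCircle.coe_sub, AddCircle.coe_eq_zero_iff]
  exact exists_congr fun m => by rw [zsmul_one, eq_comm, sub_eq_iff_eq_add']

/-- The translation number depends continuously on the parameters of a continuous family of
lifts. -/
theorem CircleDeg1Lift.continuous_translationNumber_of_continuous {X : Type*} [TopologicalSpace X]
    (G : X → CircleDeg1Lift) (hG : Continuous fun p : X × ℝ => G p.1 p.2) :
    Continuous fun t => (G t).translationNumber := by
  have hpow : ∀ n : ℕ, Continuous fun t => ((G t) ^ n) 0 := by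
    intro n
    induction n with
    | zero => simpa using continuous_const
    | succ n ih =>
      have : (fun t => ((G t) ^ (n + 1)) 0) = fun t => G t (((G t) ^ n) 0) := by
        funext t; rw [pow_succ', CircleDeg1Lift.mul_apply]
      rw [this]
      exact hG.comp (continuous_id.prodMk ih)
  -- The nth iterate of 0 differs from n times the translation number by at most 1, whatever the
  -- lift, so the convergence is uniform in the parameter.
  have hunif : TendstoUniformly (fun (n : ℕ) t => ((G t) ^ (n + 1)) 0 / ((n : ℝ) + 1))
      (fun t => (G t).translationNumber) Filter.atTop := by
    rw [Metric.tendstoUniformly_iff]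
    intro ε hε
    have h0 := (tendsto_one_div_add_atTop_nhds_zero_nat (𝕜 := ℝ)).eventually_lt_const hε
    filter_upwards [h0] with n hn t
    refine lt_of_le_of_lt ?_ hn
    have h := (G t).dist_pow_map_zero_mul_translationNumber_le (n + 1)
    have hpos : (0 : ℝ) < (n : ℝ) + 1 := by positivity
    rw [Real.dist_eq] at h ⊢
    push_cast at h
    rw [abs_sub_comm] at h
    rw [le_div_iff₀ hpos]
    calc _ = |((n : ℝ) + 1) * (G t).translationNumber - ((G t) ^ (n + 1)) 0| := by
          rw [← abs_of_pos hpos, ← abs_mul, abs_of_pos hpos]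
          congr 1; field_simp
      _ ≤ 1 := h
  exact hunif.continuous (Filter.Frequently.of_forall fun n => (hpow (n + 1)).div_const _)

/-- Strict comparison of translation numbers with a lift which is conjugate to a translation. -/
theorem CircleDeg1Lift.translationNumber_lt_of_semiconj_translate {g₁ g₂ ψ : CircleDeg1Lift}
    (hg₁ : Continuous g₁) (hψ : Continuous ψ) (hψ' : StrictMono ψ) {κ : ℝ}
    (hκ : ∀ x, ψ (g₂ x) = κ + ψ x) (hlt : ∀ x, g₁ x < g₂ x) :
    g₁.translationNumber < g₂.translationNumber := by
  have h2 : g₂.translationNumber = κ := by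
    rw [← CircleDeg1Lift.translationNumber_translate κ]
    exact CircleDeg1Lift.translationNumber_eq_of_semiconj (f := ψ) fun x => by
      rw [hκ, CircleDeg1Lift.translate_apply]
  have hsurj : Function.Surjective ψ := ψ.continuous_iff_surjective.1 hψ
  obtain ⟨U, rfl⟩ := CircleDeg1Lift.isUnit_iff_bijective.2 ⟨hψ'.injective, hsurj⟩
  -- In the coordinate ψ the lift g₂ is the translation by κ, and the conjugate of g₁ lies strictly
  -- below it everywhere. By continuity and periodicity the gap is bounded away from 0.
  rw [h2, ← CircleDeg1Lift.translationNumber_conj_eq U g₁]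
  apply CircleDeg1Lift.translationNumber_lt_of_forall_lt_add
  · have hinv : Continuous (↑U⁻¹ : CircleDeg1Lift) := by
      rw [CircleDeg1Lift.continuous_iff_surjective]
      exact fun x => ⟨U x, CircleDeg1Lift.units_inv_apply_apply U x⟩
    exact (hψ.comp hg₁).comp hinv
  · intro y
    obtain ⟨x, rfl⟩ := hsurj y
    simp only [CircleDeg1Lift.coe_mul, Function.comp_apply,
      CircleDeg1Lift.units_inv_apply_apply]
    rw [add_comm, ← hκ]
    exact hψ' (hlt x)

/-- The normalised primitive of a positive periodic density, as the lift of a circle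
homeomorphism. -/
theorem exists_circleDeg1Lift_hasDerivAt {h : ℝ → ℝ} (hc : Continuous h) (hpos : ∀ x, 0 < h x)
    (hper : ∀ x, h (x + 1) = h x) :
    ∃ (ψ : CircleDeg1Lift) (I : ℝ), 0 < I ∧ Continuous ψ ∧ StrictMono ψ ∧
      ∀ x, HasDerivAt ψ (h x / I) x := by
  set I := ∫ s in (0 : ℝ)..1, h s with hI
  have hI0 : 0 < I :=
    intervalIntegral.intervalIntegral_pos_of_pos (hc.intervalIntegrable _ _) hpos one_pos
  have hd : ∀ x, HasDerivAt (fun x => (∫ s in (0 : ℝ)..x, h s) / I) (h x / I) x := fun x =>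
    (hc.integral_hasStrictDerivAt 0 x).hasDerivAt.div_const I
  have hm : StrictMono fun x => (∫ s in (0 : ℝ)..x, h s) / I :=
    strictMono_of_deriv_pos fun x => by
      rw [(hd x).deriv]; exact div_pos (hpos x) hI0
  refine ⟨⟨⟨fun x => (∫ s in (0 : ℝ)..x, h s) / I, hm.monotone⟩, fun x => ?_⟩, I, hI0,
    continuous_iff_continuousAt.2 fun x => (hd x).continuousAt, hm, hd⟩
  have h1 : ∫ s in x..(x + 1), h s = I := by
    have := Function.Periodic.intervalIntegral_add_eq (f := h) (T := 1) hper x 0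
    rw [this, zero_add]
  have h2 := intervalIntegral.integral_add_adjacent_intervals
    (hc.intervalIntegrable (μ := MeasureTheory.volume) 0 x) (hc.intervalIntegrable x (x + 1))
  show (∫ s in (0 : ℝ)..(x + 1), h s) / I = (∫ s in (0 : ℝ)..x, h s) / I + 1
  rw [← h2, h1, add_div, div_self hI0.ne']

/-! ### Periodic orbits of circle homeomorphisms and reduced fractions. -/

namespace IsOrientedLift

variable {h : UnitAddCircle → UnitAddCircle} {g : CircleDeg1Lift}

theorem iterate_coe (H : IsOrientedLift h g) (n : ℕ) (x : ℝ) :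
    h^[n] (x : UnitAddCircle) = (((g ^ n) x : ℝ) : UnitAddCircle) := by
  induction n with
  | zero => simp
  | succ n ih =>
    rw [Function.iterate_succ_apply', ih, H.lifts, pow_succ', CircleDeg1Lift.mul_apply]

theorem isPeriodicPt_iff (H : IsOrientedLift h g) (n : ℕ) (x : ℝ) :
    Function.IsPeriodicPt h n (x : UnitAddCircle) ↔ ∃ m : ℤ, (g ^ n) x = x + m := by
  rw [Function.IsPeriodicPt, Function.IsFixedPt, H.iterate_coe, UnitAddCircle.coe_eq_coe_iff]

/-- An orientation-preserving circle homeomorphism has an orbit of exact period `q` if and only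
if its rotation number is a reduced fraction of denominator `q`. -/
theorem exists_minimalPeriod_eq_iff (H : IsOrientedLift h g) {q : ℕ} (hq : 0 < q) :
    (∃ x, Function.minimalPeriod h x = q) ↔
      ∃ m : ℤ, IsCoprime m (q : ℤ) ∧ g.translationNumber = m / q := by
  have hq0 : (q : ℝ) ≠ 0 := by positivity
  constructor
  · rintro ⟨x, hx⟩
    obtain ⟨x, rfl⟩ := QuotientAddGroup.mk_surjective x
    change Function.minimalPeriod h (x : UnitAddCircle) = q at hx
    obtain ⟨m, hm⟩ := (H.isPeriodicPt_iff q x).1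
      (hx ▸ Function.isPeriodicPt_minimalPeriod h (x : UnitAddCircle))
    refine ⟨m, ?_, g.translationNumber_of_map_pow_eq_add_int hm hq⟩
    rw [Int.isCoprime_iff_gcd_eq_one]
    obtain ⟨d, hd⟩ : ∃ d, d = Int.gcd m q := ⟨_, rfl⟩
    rw [← hd]
    obtain ⟨m', hm'⟩ : (d : ℤ) ∣ m := hd ▸ Int.gcd_dvd_left ..
    obtain ⟨q', hq'⟩ : d ∣ q := by
      have : (d : ℤ) ∣ (q : ℤ) := hd ▸ Int.gcd_dvd_right ..
      exact_mod_cast this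
    have hd0 : 0 < d := Nat.pos_of_ne_zero fun h0 => by simp [h0] at hq'; omega
    have hq'0 : 0 < q' := Nat.pos_of_ne_zero fun h0 => by simp [h0] at hq'; omega
    -- For a monotone lift, if the dth iterate of `g ^ q'` moves x by d times an integer, then `g ^
    -- q'` already moves x by that integer. A common factor d of m and q would thus shorten the
    -- period.
    have hfix : (g ^ q') x = x + m' := by
      rw [← CircleDeg1Lift.iterate_pos_eq_iff (g ^ q') hd0, ← CircleDeg1Lift.coe_pow, ← pow_mul,
        mul_comm, ← hq', hm, hm']
      push_cast; ring
    have hdvd : q ∣ q' := by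
      rw [← hx]
      exact ((H.isPeriodicPt_iff q' x).2 ⟨m', hfix⟩).minimalPeriod_dvd
    have := Nat.le_of_dvd hq'0 hdvd
    nlinarith
  · rintro ⟨m, hm, hτ⟩
    obtain ⟨x, hx⟩ := (CircleDeg1Lift.translationNumber_eq_rat_iff g H.continuous hq).1 hτ
    refine ⟨(x : UnitAddCircle), Nat.dvd_antisymm ?_ ?_⟩
    · exact ((H.isPeriodicPt_iff q x).2 ⟨m, hx⟩).minimalPeriod_dvd
    · obtain ⟨n, hn⟩ : ∃ n, n = Function.minimalPeriod h (x : UnitAddCircle) := ⟨_, rfl⟩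
      rw [← hn]
      have hn0 : 0 < n := hn ▸
        ((H.isPeriodicPt_iff q x).2 ⟨m, hx⟩).minimalPeriod_pos hq
      obtain ⟨k, hk⟩ := (H.isPeriodicPt_iff n x).1
        (hn ▸ Function.isPeriodicPt_minimalPeriod h (x : UnitAddCircle))
      have h1 := g.translationNumber_of_map_pow_eq_add_int hk hn0
      rw [hτ, div_eq_div_iff hq0 (by positivity)] at h1
      have h2 : m * n = k * q := by exact_mod_cast h1
      have h3 : (q : ℤ) ∣ m * n := ⟨k, by rw [h2, mul_comm]⟩
      exact_mod_cast hm.symm.dvd_of_dvd_mul_left h3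

end IsOrientedLift

/-- Half of the residues coprime to `q ≥ 3` lie in `[0, q/2]`. -/
theorem two_mul_card_coprime_le_half {q : ℕ} (hq : 3 ≤ q) :
    2 * ((Finset.range q).filter fun m => m.Coprime q ∧ 2 * m ≤ q).card = q.totient := by
  have hne : ∀ m, m.Coprime q → 2 * m ≠ q := by
    intro m hm h
    have h1 : m ∣ q := ⟨2, by omega⟩
    have := Nat.Coprime.eq_one_of_dvd hm h1
    omega
  have hcard : ((Finset.range q).filter fun m => m.Coprime q ∧ 2 * m ≤ q).card
      = ((Finset.range q).filter fun m => m.Coprime q ∧ ¬ 2 * m ≤ q).card := by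
    -- The reflection exchanges the two halves; `hne` excludes its fixed point q/2.
    refine Finset.card_bij' (fun m _ => q - m) (fun m _ => q - m) ?_ ?_ ?_ ?_
    · intro m hm
      simp only [Finset.mem_filter, Finset.mem_range] at hm ⊢
      have h0 : m ≠ 0 := by rintro rfl; have := hm.2.1; simp at this; omega
      have := hne m hm.2.1
      exact ⟨by omega, (Nat.coprime_self_sub_left (by omega)).2 hm.2.1, by omega⟩
    · intro m hm
      simp only [Finset.mem_filter, Finset.mem_range] at hm ⊢
      exact ⟨by omega, (Nat.coprime_self_sub_left (by omega)).2 hm.2.1, by omega⟩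
    · intro m hm
      simp only [Finset.mem_filter, Finset.mem_range] at hm
      omega
    · intro m hm
      simp only [Finset.mem_filter, Finset.mem_range] at hm
      omega
  have h := Finset.card_filter_add_card_filter_not (s := (Finset.range q).filter fun m => m.Coprime q)
    (fun m => 2 * m ≤ q)
  rw [Finset.filter_filter, Finset.filter_filter] at h
  rw [Nat.totient]
  have h3 : ((Finset.range q).filter fun m => m.Coprime q)
      = (Finset.range q).filter fun m => q.Coprime m := by
    ext m; simp [Nat.coprime_comm]
  rw [← h3, ← h, ← hcard]; ring

/-! ### Angles and tangent lengths seen from a point of K. -/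

/-- The vector `R + c e^{2πix}`; it is the mirror image, in the real axis, of the point
`c + R e^{2πix}` turned by the angle `-2πx`. -/
noncomputable def turnedPoint (c R : ℝ) (x : UnitAddCircle) : ℂ :=
  (R : ℂ) + (c : ℂ) * (AddCircle.toCircle x : ℂ)

/-- The angle at `A = c + R e^{2πix}` between the directions to `c` and to `0`. -/
noncomputable def centreAngle (c R : ℝ) (x : UnitAddCircle) : ℝ :=
  Real.arctan (c * (AddCircle.toCircle x : ℂ).im / (R + c * (AddCircle.toCircle x : ℂ).re))

/-- Half of the angle under which the circle `L_t` is seen from `A = c + R e^{2πix}`. -/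
noncomputable def halfAperture (c R t : ℝ) (x : UnitAddCircle) : ℝ :=
  Real.arcsin (t / ‖turnedPoint c R x‖)

/-- The angle at `A = c + R e^{2πix}` between the direction to `c` and the tangent to `L_t`
with `L_t` on its left. -/
noncomputable def tangentAngle (c R t : ℝ) (x : UnitAddCircle) : ℝ :=
  centreAngle c R x + halfAperture c R t x

/-- The graph map whose graph is `Γ_t`. -/
noncomputable def tangentDirection (c R t : ℝ) (x : UnitAddCircle) : UnitAddCircle :=
  2 • x - ((tangentAngle c R t x / Real.pi : ℝ) : UnitAddCircle)

section Geometry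

variable {c R t : ℝ} (hc : 0 ≤ c) (hcR : c < R) (ht : t ∈ Set.Icc 0 (R - c)) (x : UnitAddCircle)

theorem re_sq_add_im_sq_toCircle :
    (AddCircle.toCircle x : ℂ).re ^ 2 + (AddCircle.toCircle x : ℂ).im ^ 2 = 1 := by
  have := Circle.normSq_coe (AddCircle.toCircle x)
  rw [Complex.normSq_apply] at this
  linarith

theorem turnedPoint_re : (turnedPoint c R x).re = R + c * (AddCircle.toCircle x : ℂ).re := by
  simp [turnedPoint]

theorem turnedPoint_im : (turnedPoint c R x).im = c * (AddCircle.toCircle x : ℂ).im := by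
  simp [turnedPoint]

include hc in
theorem sub_le_norm_turnedPoint : R - c ≤ ‖turnedPoint c R x‖ := by
  have h : ‖(R : ℂ)‖ - ‖-((c : ℂ) * (AddCircle.toCircle x : ℂ))‖ ≤ _ := norm_sub_norm_le _ _
  rw [sub_neg_eq_add] at h
  rw [norm_neg, norm_mul, Circle.norm_coe, Complex.norm_real, Complex.norm_real, mul_one,
    Real.norm_eq_abs, Real.norm_eq_abs, abs_of_nonneg hc] at h
  exact (sub_le_sub_right (le_abs_self R) c).trans h

include hc hcR

theorem norm_turnedPoint_pos : 0 < ‖turnedPoint c R x‖ :=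
  (sub_pos.2 hcR).trans_le (sub_le_norm_turnedPoint hc x)

theorem turnedPoint_re_pos : 0 < R + c * (AddCircle.toCircle x : ℂ).re := by
  have := neg_le_of_abs_le
    ((Complex.abs_re_le_norm (AddCircle.toCircle x : ℂ)).trans_eq (Circle.norm_coe _))
  nlinarith

theorem norm_mul_cos_centreAngle :
    ‖turnedPoint c R x‖ * Real.cos (centreAngle c R x)
      = R + c * (AddCircle.toCircle x : ℂ).re := by
  have hp := turnedPoint_re_pos hc hcR x
  have hn := norm_turnedPoint_pos hc hcR x
  have hsq : ‖turnedPoint c R x‖ ^ 2 = (R + c * (AddCircle.toCircle x : ℂ).re) ^ 2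
      + (c * (AddCircle.toCircle x : ℂ).im) ^ 2 := by
    rw [← Complex.normSq_eq_norm_sq, Complex.normSq_apply, turnedPoint_re, turnedPoint_im]; ring
  rw [centreAngle, Real.cos_arctan]
  set p := R + c * (AddCircle.toCircle x : ℂ).re
  set q := c * (AddCircle.toCircle x : ℂ).im
  have : √(1 + (q / p) ^ 2) = ‖turnedPoint c R x‖ / p := by
    rw [Real.sqrt_eq_iff_eq_sq (by positivity) (by positivity), div_pow, div_pow, hsq]
    field_simp
  rw [this]; field_simp

theorem norm_mul_sin_centreAngle :
    ‖turnedPoint c R x‖ * Real.sin (centreAngle c R x) = c * (AddCircle.toCircle x : ℂ).im := by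
  have hp := turnedPoint_re_pos hc hcR x
  have hcos : Real.cos (centreAngle c R x) ≠ 0 := (Real.cos_arctan_pos _).ne'
  have h : Real.tan (centreAngle c R x) = _ := Real.tan_arctan _
  rw [Real.tan_eq_sin_div_cos, div_eq_div_iff hcos hp.ne',
    ← norm_mul_cos_centreAngle hc hcR] at h
  apply mul_right_cancel₀ hcos
  linarith

include ht

theorem div_norm_turnedPoint_mem : t / ‖turnedPoint c R x‖ ∈ Set.Icc 0 1 :=
  ⟨div_nonneg ht.1 (norm_nonneg _), (div_le_one (norm_turnedPoint_pos hc hcR x)).2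
    (ht.2.trans (sub_le_norm_turnedPoint hc x))⟩

theorem halfAperture_mem : halfAperture c R t x ∈ Set.Icc 0 (Real.pi / 2) :=
  ⟨Real.arcsin_nonneg.2 (div_norm_turnedPoint_mem hc hcR ht x).1, Real.arcsin_le_pi_div_two _⟩

theorem norm_mul_sin_halfAperture :
    ‖turnedPoint c R x‖ * Real.sin (halfAperture c R t x) = t := by
  have h := div_norm_turnedPoint_mem hc hcR ht x
  rw [halfAperture, Real.sin_arcsin (by linarith [h.1]) h.2,
    mul_div_cancel₀ _ (norm_turnedPoint_pos hc hcR x).ne']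

omit hc hcR ht in
theorem norm_mul_cos_halfAperture_nonneg :
    0 ≤ ‖turnedPoint c R x‖ * Real.cos (halfAperture c R t x) :=
  mul_nonneg (norm_nonneg _) (Real.cos_arcsin_nonneg _)

/-- With B the turned point, the left side is Im(e^{iγ} · conj B) = |B| sin(γ - τ), the signed
distance from the origin to the chord. This is the tangency equation. -/
theorem sin_tangentAngle :
    R * Real.sin (tangentAngle c R t x)
      + c * (Real.sin (tangentAngle c R t x) * (AddCircle.toCircle x : ℂ).re
        - Real.cos (tangentAngle c R t x) * (AddCircle.toCircle x : ℂ).im) = t := by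
  have h1 := norm_mul_cos_centreAngle hc hcR x
  have h2 := norm_mul_sin_centreAngle hc hcR x
  have h3 := norm_mul_sin_halfAperture hc hcR ht x
  have h4 := Real.sin_sub (tangentAngle c R t x) (centreAngle c R x)
  rw [show tangentAngle c R t x - centreAngle c R x = halfAperture c R t x by
    rw [tangentAngle]; ring] at h4
  linear_combination h3 - ‖turnedPoint c R x‖ * h4 - Real.sin (tangentAngle c R t x) * h1
    + Real.cos (tangentAngle c R t x) * h2

omit ht in
-- The companion Re(e^{iγ} · conj B) = |B| cos(γ - τ) is the signed length from A to the point of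
-- tangency.
theorem cos_tangentAngle :
    R * Real.cos (tangentAngle c R t x)
      + c * (Real.cos (tangentAngle c R t x) * (AddCircle.toCircle x : ℂ).re
        + Real.sin (tangentAngle c R t x) * (AddCircle.toCircle x : ℂ).im)
      = ‖turnedPoint c R x‖ * Real.cos (halfAperture c R t x) := by
  have h1 := norm_mul_cos_centreAngle hc hcR x
  have h2 := norm_mul_sin_centreAngle hc hcR x
  have h4 := Real.cos_sub (tangentAngle c R t x) (centreAngle c R x)
  rw [show tangentAngle c R t x - centreAngle c R x = halfAperture c R t x by
    rw [tangentAngle]; ring] at h4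
  linear_combination - ‖turnedPoint c R x‖ * h4 - Real.cos (tangentAngle c R t x) * h1
    - Real.sin (tangentAngle c R t x) * h2

omit hcR in
/-- If a line through `A` is at distance `t` from the origin, then the tangent segments from its
two intersections with `K` point in opposite directions: their signed lengths have a nonnegative
product. Here `(S, C)` is the direction of the line relative to the radius. -/
theorem tangent_lengths_mul_nonneg {S C k m : ℝ} (h1 : S ^ 2 + C ^ 2 = 1) (h2 : k ^ 2 + m ^ 2 = 1)
    (h : R * S + c * (S * k - C * m) = t) :
    0 ≤ (R * C + c * (C * k + S * m)) * (R * C - c * (C * k + S * m)) := by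
  have hs : (S * k - C * m) ^ 2 + (C * k + S * m) ^ 2 = 1 := by
    linear_combination (k ^ 2 + m ^ 2) * h1 + h2
  have hs1 : -1 ≤ S * k - C * m := by nlinarith [sq_nonneg (C * k + S * m)]
  -- The product is minus the power, with respect to K, of the foot of the perpendicular from the
  -- origin. It is at least R² - (c + t)², which is nonnegative since L_t lies inside K.
  have : (R * C + c * (C * k + S * m)) * (R * C - c * (C * k + S * m))
      = R ^ 2 - c ^ 2 - t ^ 2 + 2 * t * c * (S * k - C * m) := by
    linear_combination R ^ 2 * h1 - c ^ 2 * hs - (R * S + t - c * (S * k - C * m)) * h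
  rw [this]
  have h5 : 0 ≤ t * c := mul_nonneg ht.1 hc
  nlinarith [ht.1, ht.2]

/-- A vanishing tangent length forces |A| = t = R - c. Then A is a point of K nearest to the origin,
so A = c - R or c = 0. This is the degenerate case in the sign argument below. -/
theorem centreAngle_eq_zero_of_halfAperture (h : Real.cos (halfAperture c R t x) = 0) :
    centreAngle c R x = 0 := by
  have hβ := halfAperture_mem hc hcR ht x
  have h1 : halfAperture c R t x = Real.pi / 2 := by
    by_contra hne
    exact (Real.cos_pos_of_mem_Ioo ⟨by linarith [Real.pi_pos, hβ.1],
      lt_of_le_of_ne hβ.2 hne⟩).ne' h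
  have h2 := norm_mul_sin_halfAperture hc hcR ht x
  rw [h1, Real.sin_pi_div_two, mul_one] at h2
  have h3 : ‖turnedPoint c R x‖ = R - c :=
    le_antisymm (h2.le.trans ht.2) (sub_le_norm_turnedPoint hc x)
  have hsq : ‖turnedPoint c R x‖ ^ 2 = (R + c * (AddCircle.toCircle x : ℂ).re) ^ 2
      + (c * (AddCircle.toCircle x : ℂ).im) ^ 2 := by
    rw [← Complex.normSq_eq_norm_sq, Complex.normSq_apply, turnedPoint_re, turnedPoint_im]; ring
  have hu := re_sq_add_im_sq_toCircle x
  rw [h3] at hsq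
  have h4 : c * (1 + (AddCircle.toCircle x : ℂ).re) = 0 := by
    have hR : (2 * R) ≠ 0 := by linarith
    apply mul_left_cancel₀ hR
    linear_combination -hsq - c ^ 2 * hu
  have h5 : c * (AddCircle.toCircle x : ℂ).im = 0 := by
    rcases mul_eq_zero.1 h4 with h | h
    · rw [h, zero_mul]
    · have : (AddCircle.toCircle x : ℂ).im ^ 2 = 0 := by
        linear_combination hu - ((AddCircle.toCircle x : ℂ).re - 1) * h
      rw [pow_eq_zero_iff two_ne_zero] at this
      rw [this, mul_zero]
  rw [centreAngle, h5, zero_div, Real.arctan_zero]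

/-- The tangent length from A is nonnegative and has a nonnegative product with the one from A', so
the latter is nonnegative too unless the former vanishes. The sum of the two is the chord length 2R
cos γ. -/
theorem cos_tangentAngle_nonneg_and :
    0 ≤ R * Real.cos (tangentAngle c R t x)
      - c * (Real.cos (tangentAngle c R t x) * (AddCircle.toCircle x : ℂ).re
        + Real.sin (tangentAngle c R t x) * (AddCircle.toCircle x : ℂ).im) ∧
    0 ≤ Real.cos (tangentAngle c R t x) := by
  have hR : 0 < R := hc.trans_lt hcR
  have h1 := cos_tangentAngle hc hcR (t := t) x
  have h2 := norm_mul_cos_halfAperture_nonneg (c := c) (R := R) (t := t) x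
  have h3 := tangent_lengths_mul_nonneg hc ht (Real.sin_sq_add_cos_sq _)
    (re_sq_add_im_sq_toCircle x) (sin_tangentAngle hc hcR ht x)
  rw [h1] at h3
  rcases h2.eq_or_lt with h0 | h0
  · have h4 : Real.cos (halfAperture c R t x) = 0 :=
      (mul_eq_zero.1 h0.symm).resolve_left (norm_turnedPoint_pos hc hcR x).ne'
    have h5 : Real.cos (tangentAngle c R t x) = 0 := by
      rw [tangentAngle, centreAngle_eq_zero_of_halfAperture hc hcR ht x h4, zero_add, h4]
    rw [← h0] at h1
    rw [h5] at h1 ⊢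
    constructor <;> linarith
  · have h4 := nonneg_of_mul_nonneg_right h3 h0
    refine ⟨h4, ?_⟩
    have : 0 ≤ 2 * R * Real.cos (tangentAngle c R t x) := by linarith
    exact nonneg_of_mul_nonneg_right this (by positivity)

/-- The relation between the tangent angles at the two ends of a chord: `L_t` is seen from the
second end at the mirrored angle. -/
theorem tangentAngle_eq_of_chord {x' : UnitAddCircle}
    (hre : (AddCircle.toCircle x' : ℂ).re = -((AddCircle.toCircle x : ℂ).re
        * Real.cos (2 * tangentAngle c R t x)
      + (AddCircle.toCircle x : ℂ).im * Real.sin (2 * tangentAngle c R t x)))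
    (him : (AddCircle.toCircle x' : ℂ).im = -((AddCircle.toCircle x : ℂ).im
        * Real.cos (2 * tangentAngle c R t x)
      - (AddCircle.toCircle x : ℂ).re * Real.sin (2 * tangentAngle c R t x))) :
    tangentAngle c R t x = halfAperture c R t x' - centreAngle c R x' := by
  have hn := norm_turnedPoint_pos hc hcR x'
  have h1 := norm_mul_cos_centreAngle hc hcR x'
  have h2 := norm_mul_sin_centreAngle hc hcR x'
  have h3 := sin_tangentAngle hc hcR ht x
  obtain ⟨h4, -⟩ := cos_tangentAngle_nonneg_and hc hcR ht x
  have hβ := halfAperture_mem hc hcR ht x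
  have hτ : centreAngle c R x ∈ Set.Ioo (-(Real.pi / 2)) (Real.pi / 2) :=
    Real.arctan_mem_Ioo _
  have hτ' : centreAngle c R x' ∈ Set.Ioo (-(Real.pi / 2)) (Real.pi / 2) :=
    Real.arctan_mem_Ioo _
  have hγ : tangentAngle c R t x = centreAngle c R x + halfAperture c R t x := rfl
  have hsc := Real.sin_sq_add_cos_sq (tangentAngle c R t x)
  rw [Real.cos_two_mul, Real.sin_two_mul] at hre him
  set γ := tangentAngle c R t x
  set k := (AddCircle.toCircle x : ℂ).re
  set m := (AddCircle.toCircle x : ℂ).im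
  have hsin : ‖turnedPoint c R x'‖ * Real.sin (γ + centreAngle c R x') = t := by
    rw [Real.sin_add]
    rw [hre] at h1
    rw [him] at h2
    linear_combination h3 + Real.sin γ * h1 + Real.cos γ * h2
      - 2 * c * m * Real.cos γ * hsc
  have hcos : 0 ≤ Real.cos (γ + centreAngle c R x') := by
    refine nonneg_of_mul_nonneg_right (h4.trans_eq ?_) hn
    rw [Real.cos_add]
    rw [hre] at h1
    rw [him] at h2
    linear_combination -Real.cos γ * h1 + Real.sin γ * h2
      + 2 * c * k * Real.cos γ * hsc
  -- A priori τ + β + τ' lies between -π and 3π/2. The nonnegative cosine cuts this down to the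
  -- interval on which `arcsin` inverts the sine.
  have hrange : γ + centreAngle c R x' ∈ Set.Icc (-(Real.pi / 2)) (Real.pi / 2) := by
    have hpi := Real.pi_pos
    constructor
    · by_contra! hlt
      refine absurd hcos (not_le.2 ?_)
      rw [← Real.cos_neg]
      exact Real.cos_neg_of_pi_div_two_lt_of_lt (by linarith)
        (by linarith [hτ.1, hτ'.1, hβ.1])
    · by_contra! hlt
      refine absurd hcos (not_le.2 ?_)
      exact Real.cos_neg_of_pi_div_two_lt_of_lt (by linarith)
        (by linarith [hτ.2, hτ'.2, hβ.2])
  have : halfAperture c R t x' = γ + centreAngle c R x' := by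
    rw [halfAperture, ← Real.arcsin_sin hrange.1 hrange.2, ← hsin, mul_div_cancel_left₀ _ hn.ne']
  rw [this]; ring

end Geometry

/-! ### Γ_t as an invariant graph. -/

section Chord

variable {c R t : ℝ} (hc : 0 ≤ c) (hcR : c < R) (ht : t ∈ Set.Icc 0 (R - c)) (x : UnitAddCircle)

theorem toCircle_coe_div_pi (γ : ℝ) :
    (AddCircle.toCircle ((γ / Real.pi : ℝ) : UnitAddCircle) : ℂ)
      = (Real.cos (2 * γ) : ℂ) + (Real.sin (2 * γ) : ℂ) * Complex.I := by
  rw [AddCircle.toCircle_apply_mk, Circle.coe_exp, Complex.exp_mul_I, ← Complex.ofReal_cos,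
    ← Complex.ofReal_sin]
  have : 2 * Real.pi / 1 * (γ / Real.pi) = 2 * γ := by
    have := Real.pi_ne_zero
    field_simp
  rw [this]

theorem ponceletMap_tangentDirection_fst :
    (ponceletMap c R (x, tangentDirection c R t x)).1
      = x + ((1 / 2 - tangentAngle c R t x / Real.pi : ℝ) : UnitAddCircle) := by
  simp only [ponceletMap, tangentDirection, AddCircle.coe_sub]
  abel

theorem toCircle_tangentDirection :
    (AddCircle.toCircle (tangentDirection c R t x) : ℂ)
      = ((AddCircle.toCircle x : ℂ) * ((Real.cos (tangentAngle c R t x) : ℂ)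
        - (Real.sin (tangentAngle c R t x) : ℂ) * Complex.I)) ^ 2 := by
  rw [tangentDirection, sub_eq_add_neg, AddCircle.toCircle_add, AddCircle.toCircle_nsmul,
    AddCircle.toCircle_neg, Circle.coe_mul, Circle.coe_inv_eq_conj, Circle.coe_pow,
    toCircle_coe_div_pi, mul_pow]
  congr 1
  rw [Real.cos_two_mul', Real.sin_two_mul]
  simp only [map_add, map_mul, Complex.conj_ofReal, Complex.conj_I]
  push_cast
  linear_combination -(Complex.sin (tangentAngle c R t x)) ^ 2 * Complex.I_sq

theorem toCircle_ponceletMap_tangentDirection :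
    (AddCircle.toCircle (ponceletMap c R (x, tangentDirection c R t x)).1 : ℂ)
      = -((AddCircle.toCircle x : ℂ) * ((Real.cos (2 * tangentAngle c R t x) : ℂ)
        - (Real.sin (2 * tangentAngle c R t x) : ℂ) * Complex.I)) := by
  have h := toCircle_mul_conj x
  rw [toCircle_ponceletMap_fst, toCircle_tangentDirection]
  rw [Real.cos_two_mul', Real.sin_two_mul]
  push_cast
  linear_combination (-(AddCircle.toCircle x : ℂ) * (Complex.cos (tangentAngle c R t x)
    - Complex.sin (tangentAngle c R t x) * Complex.I) ^ 2) * h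
    - (AddCircle.toCircle x : ℂ) * (Complex.sin (tangentAngle c R t x)) ^ 2 * Complex.I_sq

include hc hcR ht

theorem tangentAngle_ponceletMap :
    tangentAngle c R t x
      = halfAperture c R t (ponceletMap c R (x, tangentDirection c R t x)).1
        - centreAngle c R (ponceletMap c R (x, tangentDirection c R t x)).1 := by
  apply tangentAngle_eq_of_chord hc hcR ht
  · rw [toCircle_ponceletMap_tangentDirection]
    simp [-Complex.ofReal_cos, -Complex.ofReal_sin]
  · rw [toCircle_ponceletMap_tangentDirection]
    simp [-Complex.ofReal_cos, -Complex.ofReal_sin]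
    ring

theorem ponceletMap_tangentDirection_snd :
    (ponceletMap c R (x, tangentDirection c R t x)).2
      = tangentDirection c R t (ponceletMap c R (x, tangentDirection c R t x)).1 := by
  have h := tangentAngle_ponceletMap hc hcR ht x
  have h1 := ponceletMap_tangentDirection_fst (c := c) (R := R) (t := t) x
  have h2 : (ponceletMap c R (x, tangentDirection c R t x)).2
      = 3 • tangentDirection c R t x - 4 • x
        + ponceletZ c R (ponceletMap c R (x, tangentDirection c R t x)).1 := rfl
  rw [h2]
  set x' := (ponceletMap c R (x, tangentDirection c R t x)).1
  rw [tangentDirection, tangentDirection, h1]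
  have hZ : ponceletZ c R x' = ((-(2 * centreAngle c R x') / Real.pi : ℝ) : UnitAddCircle) := rfl
  rw [h1] at hZ h
  rw [hZ]
  set y := x + ((1 / 2 - tangentAngle c R t x / Real.pi : ℝ) : UnitAddCircle)
  have hy : tangentAngle c R t y = centreAngle c R y + halfAperture c R t y := rfl
  have hreal : ((-(3 * (tangentAngle c R t x / Real.pi))
      + -(2 * centreAngle c R y) / Real.pi : ℝ) : UnitAddCircle)
      = ((2 * (1 / 2 - tangentAngle c R t x / Real.pi) - tangentAngle c R t y / Real.pi : ℝ) :
        UnitAddCircle) := by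
    rw [UnitAddCircle.coe_eq_coe_iff]
    -- The integer is twice the half turn 1/2 in the formula for x'.
    refine ⟨-1, ?_⟩
    rw [hy]
    push_cast
    rw [show halfAperture c R t y = tangentAngle c R t x + centreAngle c R y by linarith]
    ring
  have e1 : ∀ r : ℝ, ((3 * r : ℝ) : UnitAddCircle) = 3 • (r : UnitAddCircle) := fun r => by
    rw [← AddCircle.coe_nsmul, nsmul_eq_mul]; rfl
  have e2 : ∀ r : ℝ, ((2 * r : ℝ) : UnitAddCircle) = 2 • (r : UnitAddCircle) := fun r => by
    rw [← AddCircle.coe_nsmul, nsmul_eq_mul]; rfl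
  rw [AddCircle.coe_add, AddCircle.coe_neg, e1, AddCircle.coe_sub, e2] at hreal
  calc _ = 2 • x + (-(3 • ((tangentAngle c R t x / Real.pi : ℝ) : UnitAddCircle))
      + ((-(2 * centreAngle c R y) / Real.pi : ℝ) : UnitAddCircle)) := by abel
    _ = _ := by rw [hreal]; simp only [y]; abel

theorem mem_tangentFlags_of_eq : (x, tangentDirection c R t x) ∈ tangentFlags c R t := by
  have hR : 0 < R := hc.trans_lt hcR
  have ha := toCircle_mul_conj x
  have h1 := sin_tangentAngle hc hcR ht x
  obtain ⟨-, h2⟩ := cos_tangentAngle_nonneg_and hc hcR ht x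
  have hx' := toCircle_ponceletMap_tangentDirection (c := c) (R := R) (t := t) x
  have hsc := Real.sin_sq_add_cos_sq (tangentAngle c R t x)
  -- The inward radius turned clockwise by γ; the chord in this direction has length 2R cos γ.
  refine ⟨-((AddCircle.toCircle x : ℂ) * ((Real.cos (tangentAngle c R t x) : ℂ)
        - (Real.sin (tangentAngle c R t x) : ℂ) * Complex.I)), ?_,
        ⟨2 * R * Real.cos (tangentAngle c R t x), by positivity, ?_⟩, ?_⟩
  · rw [neg_sq, toCircle_tangentDirection]
  · simp only [boundaryPoint]
    rw [hx', Real.cos_two_mul, Real.sin_two_mul]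
    push_cast
    ring
  · have ha' := re_sq_add_im_sq_toCircle x
    simp only [boundaryPoint]
    set k := (AddCircle.toCircle x : ℂ).re
    set m := (AddCircle.toCircle x : ℂ).im
    simp [-Complex.ofReal_cos, -Complex.ofReal_sin]
    linear_combination h1 + R * Real.sin (tangentAngle c R t x) * ha'

theorem eq_of_mem_tangentFlags {y : UnitAddCircle} (h : (x, y) ∈ tangentFlags c R t) :
    y = tangentDirection c R t x := by
  obtain ⟨u, hu, ⟨s, hs, hsu⟩, him⟩ := h
  have hR : 0 < R := hc.trans_lt hcR
  have ha := toCircle_mul_conj x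
  have huu := mul_conj_of_sq_eq_toCircle y u hu
  apply AddCircle.injective_toCircle one_ne_zero
  apply Subtype.ext
  rw [toCircle_tangentDirection, ← hu]
  -- The direction relative to the inward radius; the goal becomes v = e^{iγ}. Multiplied by conj B,
  -- both have imaginary part t and the same modulus, so only the sign of the real part remains to
  -- be settled.
  obtain ⟨v, hv⟩ : ∃ v : ℂ, v = -(AddCircle.toCircle x : ℂ) * (starRingEnd ℂ) u := ⟨_, rfl⟩
  have huv : u = -(AddCircle.toCircle x : ℂ) * (starRingEnd ℂ) v := by
    rw [hv]; simp only [map_mul, map_neg, Complex.conj_conj]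
    linear_combination -u * ha
  have hvv : v * (starRingEnd ℂ) v = 1 := by
    rw [hv]; simp only [map_mul, map_neg, Complex.conj_conj]
    linear_combination huu + u * (starRingEnd ℂ) u * ha
  have hvn : v.im ^ 2 + v.re ^ 2 = 1 := by
    rw [Complex.mul_conj] at hvv
    have : Complex.normSq v = 1 := by exact_mod_cast hvv
    rw [Complex.normSq_apply] at this
    linarith
  -- the chord has direction `-a conj v` and length `2 R Re v`
  have hsv : s = 2 * R * v.re := by
    have h1 := toCircle_ponceletMap_fst c R (x, y)
    rw [← hu] at h1
    simp only [boundaryPoint, h1] at hsu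
    have h2 : (s : ℂ) = R * (v + (starRingEnd ℂ) v) := by
      rw [huv] at hsu
      linear_combination (starRingEnd ℂ (AddCircle.toCircle x : ℂ)) * v * hsu
        + (R * (starRingEnd ℂ) v * ((AddCircle.toCircle x : ℂ)
          * (starRingEnd ℂ) (AddCircle.toCircle x : ℂ)) ^ 2 - s) * hvv
        + (R * v + R * (starRingEnd ℂ) v * ((AddCircle.toCircle x : ℂ)
          * (starRingEnd ℂ) (AddCircle.toCircle x : ℂ) + 1)
          - s * (v * (starRingEnd ℂ) v)) * ha
    rw [Complex.add_conj] at h2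
    have h3 : s = R * (2 * v.re) := by exact_mod_cast h2
    linarith
  have ha' := re_sq_add_im_sq_toCircle x
  have ht' : R * v.im + c * (v.im * (AddCircle.toCircle x : ℂ).re
      - v.re * (AddCircle.toCircle x : ℂ).im) = t := by
    rw [← him, huv]
    simp [boundaryPoint]
    linear_combination -R * v.im * ha'
  have hprod := tangent_lengths_mul_nonneg hc ht hvn ha' ht'
  have hsin := sin_tangentAngle hc hcR ht x
  have hcos := cos_tangentAngle hc hcR (t := t) x
  have hP := norm_mul_cos_halfAperture_nonneg (c := c) (R := R) (t := t) x
  rw [← hcos] at hP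
  have hsc := Real.sin_sq_add_cos_sq (tangentAngle c R t x)
  set k := (AddCircle.toCircle x : ℂ).re with hk
  set m := (AddCircle.toCircle x : ℂ).im with hm
  -- The orientation from A to A' enters here: the two signed tangent lengths have a nonnegative
  -- product and sum to s ≥ 0, so neither can be negative.
  have hP' : 0 ≤ R * v.re + c * (v.re * k + v.im * m) := by
    by_contra! hlt
    have := nonpos_of_mul_nonneg_right hprod hlt
    linarith
  have heq : R * v.re + c * (v.re * k + v.im * m)
      = R * Real.cos (tangentAngle c R t x) + c * (Real.cos (tangentAngle c R t x) * k
        + Real.sin (tangentAngle c R t x) * m) := by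
    rw [← sq_eq_sq₀ hP' hP]
    linear_combination ((R + c * k) ^ 2 + (c * m) ^ 2) * (hvn - hsc)
      - (R * v.im + c * (v.im * k - v.re * m) + t) * ht'
      + (R * Real.sin (tangentAngle c R t x) + c * (Real.sin (tangentAngle c R t x) * k
        - Real.cos (tangentAngle c R t x) * m) + t) * hsin
  have hw : v = (Real.cos (tangentAngle c R t x) : ℂ)
      + (Real.sin (tangentAngle c R t x) : ℂ) * Complex.I := by
    have hB : (starRingEnd ℂ) (turnedPoint c R x) ≠ 0 := by
      simpa using norm_pos_iff.1 (norm_turnedPoint_pos hc hcR x)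
    apply mul_right_cancel₀ hB
    apply Complex.ext
    · simp [-Complex.ofReal_cos, -Complex.ofReal_sin, turnedPoint_re, turnedPoint_im,
        ← hk, ← hm]
      linear_combination heq
    · simp [-Complex.ofReal_cos, -Complex.ofReal_sin, turnedPoint_re, turnedPoint_im,
        ← hk, ← hm]
      linear_combination ht' - hsin
  rw [huv, hw]
  simp only [map_add, map_mul, Complex.conj_ofReal, Complex.conj_I]
  ring

theorem tangentFlags_eq_range :
    tangentFlags c R t = Set.range fun x => (x, tangentDirection c R t x) := by
  ext ⟨x, y⟩
  constructor
  · intro h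
    exact ⟨x, by rw [eq_of_mem_tangentFlags hc hcR ht x h]⟩
  · rintro ⟨x', h⟩
    rw [← h]
    exact mem_tangentFlags_of_eq hc hcR ht x'

end Chord

/-! ### The lift of the map A ↦ A'. -/

/-- The lift to `ℝ` of the Poncelet map restricted to `Γ_t`. -/
noncomputable def chordStep (c R t x : ℝ) : ℝ :=
  x + (1 / 2 - tangentAngle c R t (x : UnitAddCircle) / Real.pi)

section Lift

variable {c R t : ℝ} (hc : 0 ≤ c) (hcR : c < R) (ht : t ∈ Set.Icc 0 (R - c))

theorem graphMap_tangentDirection_coe (x : ℝ) :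
    graphMap (ponceletMap c R) (tangentDirection c R t) (x : UnitAddCircle)
      = (chordStep c R t x : UnitAddCircle) := by
  rw [graphMap, ponceletMap_tangentDirection_fst, chordStep, AddCircle.coe_add]

theorem chordStep_add_one (x : ℝ) : chordStep c R t (x + 1) = chordStep c R t x + 1 := by
  rw [chordStep, chordStep, AddCircle.coe_add_period]
  ring

theorem toCircle_coe (x : ℝ) : (AddCircle.toCircle (x : UnitAddCircle) : ℂ)
    = (Real.cos (2 * Real.pi * x) : ℂ) + (Real.sin (2 * Real.pi * x) : ℂ) * Complex.I := by
  have h := toCircle_coe_div_pi (Real.pi * x)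
  rwa [mul_div_cancel_left₀ _ Real.pi_ne_zero, ← mul_assoc] at h

theorem toCircle_coe_re (x : ℝ) :
    (AddCircle.toCircle (x : UnitAddCircle) : ℂ).re = Real.cos (2 * Real.pi * x) := by
  rw [toCircle_coe]; simp [-Complex.ofReal_cos, -Complex.ofReal_sin]

theorem toCircle_coe_im (x : ℝ) :
    (AddCircle.toCircle (x : UnitAddCircle) : ℂ).im = Real.sin (2 * Real.pi * x) := by
  rw [toCircle_coe]; simp [-Complex.ofReal_cos, -Complex.ofReal_sin]

theorem continuous_turnedPoint : Continuous (turnedPoint c R) :=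
  continuous_const.add (continuous_const.mul
    (continuous_subtype_val.comp AddCircle.continuous_toCircle))

include hc hcR

theorem continuous_centreAngle : Continuous (centreAngle c R) := by
  have h := continuous_turnedPoint (c := c) (R := R)
  have h1 := Complex.continuous_re.comp h
  have h2 := Complex.continuous_im.comp h
  have : centreAngle c R = fun x => Real.arctan ((turnedPoint c R x).im / (turnedPoint c R x).re) := by
    funext x
    rw [turnedPoint_re, turnedPoint_im, centreAngle]
  rw [this]
  exact Real.continuous_arctan.comp (h2.div h1 fun x => by
    simpa [turnedPoint_re] using (turnedPoint_re_pos hc hcR x).ne')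

theorem continuous_tangentAngle_uncurry :
    Continuous fun p : ℝ × UnitAddCircle => tangentAngle c R p.1 p.2 := by
  refine ((continuous_centreAngle hc hcR).comp continuous_snd).add
    (Real.continuous_arcsin.comp (continuous_fst.div
      (continuous_turnedPoint.norm.comp continuous_snd) fun p => ?_))
  exact (norm_turnedPoint_pos hc hcR p.2).ne'

theorem continuous_tangentDirection : Continuous (tangentDirection c R t) :=
  (continuous_id.nsmul 2).sub ((AddCircle.continuous_mk' 1).comp
    (((continuous_tangentAngle_uncurry hc hcR).comp
      (continuous_const.prodMk continuous_id)).div_const _))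

theorem continuous_chordStep_uncurry :
    Continuous fun p : ℝ × ℝ => chordStep c R p.1 p.2 :=
  continuous_snd.add (continuous_const.sub (((continuous_tangentAngle_uncurry hc hcR).comp
    (continuous_fst.prodMk ((AddCircle.continuous_mk' 1).comp continuous_snd))).div_const _))

theorem continuous_chordStep : Continuous (chordStep c R t) :=
  (continuous_chordStep_uncurry hc hcR).comp (continuous_const.prodMk continuous_id)

theorem chordStep_lt_chordStep {s : ℝ} (hs : s ∈ Set.Icc 0 (R - c)) (ht : t ∈ Set.Icc 0 (R - c))
    (hst : s < t) (x : ℝ) : chordStep c R t x < chordStep c R s x := by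
  have h1 := div_norm_turnedPoint_mem hc hcR hs (x : UnitAddCircle)
  have h2 := div_norm_turnedPoint_mem hc hcR ht (x : UnitAddCircle)
  have h : halfAperture c R s (x : UnitAddCircle) < halfAperture c R t (x : UnitAddCircle) :=
    Real.strictMonoOn_arcsin ⟨by linarith [h1.1], h1.2⟩ ⟨by linarith [h2.1], h2.2⟩
      (div_lt_div_of_pos_right hst (norm_turnedPoint_pos hc hcR _))
  simp only [chordStep, tangentAngle]
  gcongr

include ht

theorem tangentAngle_chordStep (x : ℝ) :
    tangentAngle c R t (x : UnitAddCircle)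
      = halfAperture c R t (chordStep c R t x : UnitAddCircle)
        - centreAngle c R (chordStep c R t x : UnitAddCircle) := by
  rw [← graphMap_tangentDirection_coe]
  exact tangentAngle_ponceletMap hc hcR ht x

/-- The mirrored angle at the second end supplies an explicit left inverse. A continuous injection
is strictly monotone, and degree one excludes the decreasing case. -/
theorem strictMono_chordStep : StrictMono (chordStep c R t) := by
  have hinj : Function.Injective (chordStep c R t) := by
    refine Function.LeftInverse.injective (g := fun y : ℝ => y - 1 / 2
      + (halfAperture c R t (y : UnitAddCircle) - centreAngle c R (y : UnitAddCircle)) / Real.pi)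
      fun x => ?_
    simp only
    rw [← tangentAngle_chordStep hc hcR ht, chordStep]
    ring
  refine ((continuous_chordStep hc hcR).strictMono_of_inj hinj).resolve_right fun h => ?_
  have h1 := h (zero_lt_one' ℝ)
  have h2 := chordStep_add_one (c := c) (R := R) (t := t) 0
  rw [zero_add] at h2
  linarith

/-- `chordStep` as a lift of degree one. -/
noncomputable def ponceletLift : CircleDeg1Lift :=
  ⟨⟨chordStep c R t, (strictMono_chordStep hc hcR ht).monotone⟩, chordStep_add_one⟩

theorem isOrientedLift_ponceletLift :
    IsOrientedLift (graphMap (ponceletMap c R) (tangentDirection c R t))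
      (ponceletLift hc hcR ht) where
  continuous := continuous_chordStep hc hcR
  strictMono := strictMono_chordStep hc hcR ht
  lifts := graphMap_tangentDirection_coe

theorem semiconj_graphMap :
    Function.Semiconj (fun x => (x, tangentDirection c R t x))
      (graphMap (ponceletMap c R) (tangentDirection c R t)) (ponceletMap c R) := fun x =>
  Prod.ext rfl (ponceletMap_tangentDirection_snd hc hcR ht x).symm

theorem surjective_graphMap :
    Function.Surjective (graphMap (ponceletMap c R) (tangentDirection c R t)) := by
  intro y
  obtain ⟨y, rfl⟩ := QuotientAddGroup.mk_surjective y
  obtain ⟨x, hx⟩ := (ponceletLift hc hcR ht).continuous_iff_surjective.1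
    (continuous_chordStep hc hcR) y
  exact ⟨x, by rw [(isOrientedLift_ponceletLift hc hcR ht).lifts, hx]⟩

theorem isInvariantRotationalCircle_tangentFlags :
    IsInvariantRotationalCircle (ponceletMap c R) (tangentFlags c R t) := by
  refine ⟨?_, tangentDirection c R t, continuous_tangentDirection hc hcR,
    tangentFlags_eq_range hc hcR ht, ponceletLift hc hcR ht,
    isOrientedLift_ponceletLift hc hcR ht⟩
  rw [tangentFlags_eq_range hc hcR ht, ← Set.range_comp,
    ← (semiconj_graphMap hc hcR ht).comp_eq, Set.range_comp,
    (surjective_graphMap hc hcR ht).range_eq, Set.image_univ]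

/-- The tangent length from A' in terms of the data at A, namely the chord length minus the tangent
length from A. It becomes the numerator of the derivative. -/
theorem norm_mul_cos_halfAperture_chordStep (x : ℝ) :
    ‖turnedPoint c R (chordStep c R t x : UnitAddCircle)‖
        * Real.cos (halfAperture c R t (chordStep c R t x : UnitAddCircle))
      = R * Real.cos (tangentAngle c R t (x : UnitAddCircle))
        - c * (Real.cos (tangentAngle c R t (x : UnitAddCircle)) * Real.cos (2 * Real.pi * x)
        + Real.sin (tangentAngle c R t (x : UnitAddCircle)) * Real.sin (2 * Real.pi * x)) := by
  have h1 := norm_mul_cos_centreAngle hc hcR (chordStep c R t x : UnitAddCircle)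
  have h2 := norm_mul_sin_centreAngle hc hcR (chordStep c R t x : UnitAddCircle)
  have h3 := tangentAngle_chordStep hc hcR ht x
  rw [toCircle_coe_re] at h1
  rw [toCircle_coe_im] at h2
  have harg : 2 * Real.pi * chordStep c R t x
      = 2 * Real.pi * x - 2 * tangentAngle c R t (x : UnitAddCircle) + Real.pi := by
    have := Real.pi_ne_zero
    rw [chordStep]; field_simp; ring
  rw [harg, Real.cos_add_pi, Real.cos_sub, Real.cos_two_mul, Real.sin_two_mul] at h1
  rw [harg, Real.sin_add_pi, Real.sin_sub, Real.cos_two_mul, Real.sin_two_mul] at h2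
  rw [show halfAperture c R t (chordStep c R t x : UnitAddCircle)
    = tangentAngle c R t (x : UnitAddCircle)
      + centreAngle c R (chordStep c R t x : UnitAddCircle) by linarith, Real.cos_add]
  have hsc := Real.sin_sq_add_cos_sq (tangentAngle c R t (x : UnitAddCircle))
  linear_combination Real.cos (tangentAngle c R t (x : UnitAddCircle)) * h1
    - Real.sin (tangentAngle c R t (x : UnitAddCircle)) * h2
    - 2 * c * Real.cos (2 * Real.pi * x) * Real.cos (tangentAngle c R t (x : UnitAddCircle)) * hsc

end Lift

/-! ### The invariant density for t < R - c. -/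

section Density

variable {c R t : ℝ} (hc : 0 ≤ c) (hcR : c < R) (ht : t ∈ Set.Ico 0 (R - c))

include hc hcR ht

theorem tangent_length_pos (x : UnitAddCircle) :
    0 < ‖turnedPoint c R x‖ * Real.cos (halfAperture c R t x) := by
  have hn := norm_turnedPoint_pos hc hcR x
  have h0 := (halfAperture_mem hc hcR ⟨ht.1, ht.2.le⟩ x).1
  have hlt : halfAperture c R t x < Real.pi / 2 :=
    Real.arcsin_lt_pi_div_two.2
      ((div_lt_one hn).2 (ht.2.trans_le (sub_le_norm_turnedPoint hc x)))
  exact mul_pos hn (Real.cos_pos_of_mem_Ioo ⟨by linarith [Real.pi_pos], hlt⟩)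

theorem differentiable_tangentAngle :
    Differentiable ℝ fun x : ℝ => tangentAngle c R t (x : UnitAddCircle) := by
  intro x
  have h1 : (fun x : ℝ => ‖turnedPoint c R (x : UnitAddCircle)‖) = fun x : ℝ =>
      √((R + c * Real.cos (2 * Real.pi * x)) ^ 2 + (c * Real.sin (2 * Real.pi * x)) ^ 2) := by
    funext y
    rw [Complex.norm_eq_sqrt_sq_add_sq, turnedPoint_re, turnedPoint_im, toCircle_coe_re,
      toCircle_coe_im]
  have hn := norm_turnedPoint_pos hc hcR (x : UnitAddCircle)
  have hre := turnedPoint_re_pos hc hcR (x : UnitAddCircle)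
  have hd : DifferentiableAt ℝ (fun x : ℝ => ‖turnedPoint c R (x : UnitAddCircle)‖) x := by
    rw [h1]
    refine DifferentiableAt.sqrt (by fun_prop) (Real.sqrt_ne_zero'.1 ?_).ne'
    exact (congrFun h1 x).symm.trans_ne hn.ne'
  refine DifferentiableAt.add ?_ ?_
  · simp only [centreAngle, toCircle_coe_re, toCircle_coe_im]
    rw [toCircle_coe_re] at hre
    have h2 : DifferentiableAt ℝ (fun x : ℝ => c * Real.sin (2 * Real.pi * x)) x := by fun_prop
    have h3 : DifferentiableAt ℝ (fun x : ℝ => R + c * Real.cos (2 * Real.pi * x)) x := by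
      fun_prop
    exact (h2.div h3 hre.ne').arctan
  · have hmem := div_norm_turnedPoint_mem hc hcR ⟨ht.1, ht.2.le⟩ (x : UnitAddCircle)
    have hlt : t / ‖turnedPoint c R (x : UnitAddCircle)‖ < 1 :=
      (div_lt_one hn).2 (ht.2.trans_le (sub_le_norm_turnedPoint hc _))
    exact (Real.differentiableAt_arcsin.2 ⟨by linarith [hmem.1], hlt.ne⟩).comp x
      ((differentiableAt_const t).div hd hn.ne')

/-- The derivative of the circle map `A ↦ A'` is the quotient of the lengths of the tangents from
`A'` and from `A` to `L_t`. -/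
theorem hasDerivAt_chordStep (x : ℝ) :
    HasDerivAt (chordStep c R t)
      (‖turnedPoint c R (chordStep c R t x : UnitAddCircle)‖
        * Real.cos (halfAperture c R t (chordStep c R t x : UnitAddCircle))
      / (‖turnedPoint c R (x : UnitAddCircle)‖
        * Real.cos (halfAperture c R t (x : UnitAddCircle)))) x := by
  have ht' : t ∈ Set.Icc 0 (R - c) := ⟨ht.1, ht.2.le⟩
  have hP := tangent_length_pos hc hcR ht (x : UnitAddCircle)
  have hcos := cos_tangentAngle hc hcR (t := t) (x : UnitAddCircle)
  rw [toCircle_coe_re, toCircle_coe_im] at hcos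
  have hd := (differentiable_tangentAngle hc hcR ht x).hasDerivAt
  set γ' := deriv (fun x : ℝ => tangentAngle c R t (x : UnitAddCircle)) x
  have hlin : HasDerivAt (fun x : ℝ => 2 * Real.pi * x) (2 * Real.pi) x := by
    simpa using (hasDerivAt_id x).const_mul (2 * Real.pi)
  -- Implicit differentiation: the tangency equation `sin_tangentAngle` is constant in x, which
  -- gives a linear equation for γ' without differentiating the arctangent and arcsine explicitly.
  have himp := (hd.sin.const_mul R).add
    (((hd.sin.mul hlin.cos).sub (hd.cos.mul hlin.sin)).const_mul c)
  have hzero := (himp.congr_of_eventuallyEq (f₁ := fun _ => t)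
    (Filter.Eventually.of_forall fun y => by
      have h := (sin_tangentAngle hc hcR ht' (y : UnitAddCircle)).symm
      rwa [toCircle_coe_re, toCircle_coe_im] at h)).unique (hasDerivAt_const x t)
  have hstep : HasDerivAt (chordStep c R t) (1 + (0 - γ' / Real.pi)) x :=
    (hasDerivAt_id x).add ((hasDerivAt_const x (1 / 2 : ℝ)).sub (hd.div_const Real.pi))
  convert hstep using 1
  rw [norm_mul_cos_halfAperture_chordStep hc hcR ht', div_eq_iff hP.ne', ← hcos]
  rw [← hcos] at hP
  have hpi := Real.pi_ne_zero
  field_simp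
  linear_combination hzero

/-- For `t < R - c` the map `A ↦ A'` has an invariant density, the inverse of the length of the
tangent to `L_t`, so it is conjugate to a rotation. -/
theorem exists_semiconj_translate :
    ∃ (ψ : CircleDeg1Lift) (κ : ℝ), Continuous ψ ∧ StrictMono ψ ∧
      ∀ x, ψ (chordStep c R t x) = κ + ψ x := by
  have hpos := tangent_length_pos hc hcR ht
  have hcont : Continuous fun x : ℝ => (‖turnedPoint c R (x : UnitAddCircle)‖
      * Real.cos (halfAperture c R t (x : UnitAddCircle)))⁻¹ := by
    refine Continuous.inv₀ (Continuous.mul ?_ (Real.continuous_cos.comp ?_))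
      fun x => (hpos x).ne'
    · exact (continuous_turnedPoint.comp (AddCircle.continuous_mk' 1)).norm
    · exact Real.continuous_arcsin.comp (continuous_const.div
        (continuous_turnedPoint.comp (AddCircle.continuous_mk' 1)).norm
        fun x => (norm_turnedPoint_pos hc hcR _).ne')
  obtain ⟨ψ, I, hI, hψ, hψ', hd⟩ := exists_circleDeg1Lift_hasDerivAt hcont
    (fun x => inv_pos.2 (hpos x)) (fun x => by rw [AddCircle.coe_add_period])
  -- By the chain rule the tangent length at x' cancels, and both terms have derivative 1/(I ·
  -- P(x)).
  have hdiff : ∀ x, HasDerivAt (fun x => ψ (chordStep c R t x) - ψ x) 0 x := by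
    intro x
    have h := ((hd (chordStep c R t x)).comp x (hasDerivAt_chordStep hc hcR ht x)).sub (hd x)
    refine h.congr_deriv ?_
    have h1 := (hpos (x : UnitAddCircle)).ne'
    have h2 := (hpos (chordStep c R t x : UnitAddCircle)).ne'
    rw [sub_eq_zero, div_mul_div_comm, inv_mul_cancel₀ h2, div_eq_div_iff
      (mul_ne_zero hI.ne' h1) hI.ne', mul_comm I, ← mul_assoc, inv_mul_cancel₀ h1]
  refine ⟨ψ, ψ (chordStep c R t 0) - ψ 0, hψ, hψ', fun x => ?_⟩
  have := is_const_of_deriv_eq_zero (fun x => (hdiff x).differentiableAt)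
    (fun x => (hdiff x).deriv) x 0
  linarith

end Density

/-! ### Rotation numbers and the count of circles. -/

section Rotation

variable {c R t : ℝ} (hc : 0 ≤ c) (hcR : c < R)

include hc hcR

theorem eq_of_tangentDirection_eq {s : ℝ} (hs : s ∈ Set.Icc 0 (R - c))
    (ht : t ∈ Set.Icc 0 (R - c)) (x : UnitAddCircle)
    (h : tangentDirection c R s x = tangentDirection c R t x) : s = t := by
  rw [tangentDirection, tangentDirection, sub_right_inj, UnitAddCircle.coe_eq_coe_iff] at h
  obtain ⟨m, hm⟩ := h
  have h1 := halfAperture_mem hc hcR hs x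
  have h2 := halfAperture_mem hc hcR ht x
  have hpi := Real.pi_pos
  rw [div_eq_iff hpi.ne', add_mul, div_mul_cancel₀ _ hpi.ne', tangentAngle, tangentAngle] at hm
  -- Directions fix γ only modulo π, but two half apertures in [0, π/2] differ by less than π.
  have hm0 : m = 0 := by
    have h3 : (m : ℝ) < 1 := by
      by_contra! h; nlinarith [h1.2, h2.1]
    have h4 : (-1 : ℝ) < m := by
      by_contra! h; nlinarith [h1.1, h2.2]
    have h3' : m < 1 := by exact_mod_cast h3
    have h4' : -1 < m := by exact_mod_cast h4
    omega
  rw [hm0, Int.cast_zero, zero_mul, add_zero] at hm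
  rw [← norm_mul_sin_halfAperture hc hcR hs x, ← norm_mul_sin_halfAperture hc hcR ht x,
    add_left_cancel hm]

theorem pairwiseDisjoint_tangentFlags :
    (Set.Icc 0 (R - c)).PairwiseDisjoint (tangentFlags c R) := by
  intro s hs t ht hst
  rw [Function.onFun, Set.disjoint_left]
  rintro ⟨x, y⟩ h1 h2
  exact hst (eq_of_tangentDirection_eq hc hcR hs ht x
    ((eq_of_mem_tangentFlags hc hcR hs x h1).symm.trans (eq_of_mem_tangentFlags hc hcR ht x h2)))

theorem injOn_tangentFlags : Set.InjOn (tangentFlags c R) (Set.Icc 0 (R - c)) := by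
  intro s hs t ht hst
  by_contra hne
  refine Set.disjoint_left.1 (pairwiseDisjoint_tangentFlags hc hcR hs ht hne)
    (mem_tangentFlags_of_eq hc hcR hs 0) ?_
  rw [← hst]
  exact mem_tangentFlags_of_eq hc hcR hs 0

/-- The rotation number of the Poncelet map on `Γ_t`, as the translation number of `chordStep`. -/
noncomputable def ponceletRotation : ℝ → ℝ :=
  Set.IccExtend (sub_nonneg.2 hcR.le) fun t : Set.Icc 0 (R - c) =>
    (ponceletLift hc hcR t.2).translationNumber

theorem ponceletRotation_eq (ht : t ∈ Set.Icc 0 (R - c)) :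
    ponceletRotation hc hcR t = (ponceletLift hc hcR ht).translationNumber :=
  Set.IccExtend_of_mem _ _ ht

theorem continuous_ponceletRotation : Continuous (ponceletRotation hc hcR) :=
  Continuous.Icc_extend' (CircleDeg1Lift.continuous_translationNumber_of_continuous _
    ((continuous_chordStep_uncurry hc hcR).comp
      ((continuous_subtype_val.comp continuous_fst).prodMk continuous_snd)))

/-- Only the lift of the smaller parameter must be conjugate to a translation. That parameter is
always below R - c, so the endpoint needs no separate treatment. -/
theorem strictAntiOn_ponceletRotation :
    StrictAntiOn (ponceletRotation hc hcR) (Set.Icc 0 (R - c)) := by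
  intro s hs t ht hst
  rw [ponceletRotation_eq hc hcR hs, ponceletRotation_eq hc hcR ht]
  obtain ⟨ψ, κ, hψ, hψ', hκ⟩ := exists_semiconj_translate hc hcR ⟨hs.1, hst.trans_le ht.2⟩
  exact CircleDeg1Lift.translationNumber_lt_of_semiconj_translate
    (continuous_chordStep hc hcR) hψ hψ' hκ (chordStep_lt_chordStep hc hcR hs ht hst)

/-- The real diameter passes through the origin, so its ends x = 0 and x = 1/2 form a 2-cycle that
winds once around the circle. -/
theorem ponceletRotation_zero : ponceletRotation hc hcR 0 = 1 / 2 := by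
  have ht : (0 : ℝ) ∈ Set.Icc 0 (R - c) := ⟨le_rfl, sub_nonneg.2 hcR.le⟩
  rw [ponceletRotation_eq hc hcR ht]
  have h0 : chordStep c R 0 0 = 1 / 2 := by
    simp [chordStep, tangentAngle, centreAngle, halfAperture]
  have h1 : chordStep c R 0 (1 / 2) = 1 := by
    rw [chordStep, tangentAngle, centreAngle, toCircle_half]
    simp [halfAperture]
    norm_num
  have h2 : ((ponceletLift hc hcR ht) ^ 2) 0 = 0 + ((1 : ℤ) : ℝ) := by
    rw [pow_two, CircleDeg1Lift.mul_apply]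
    change chordStep c R 0 (chordStep c R 0 0) = _
    rw [h0, h1]; simp
  rw [CircleDeg1Lift.translationNumber_of_map_pow_eq_add_int _ h2 two_pos]
  norm_num

/-- At x = 1/2, the point c - R where L_{R-c} touches K, the chord degenerates to the common tangent
and the lift has a fixed point. -/
theorem ponceletRotation_sub : ponceletRotation hc hcR (R - c) = 0 := by
  have ht : R - c ∈ Set.Icc 0 (R - c) := ⟨sub_nonneg.2 hcR.le, le_rfl⟩
  rw [ponceletRotation_eq hc hcR ht]
  have hpos : 0 < R - c := sub_pos.2 hcR
  have h1 : chordStep c R (R - c) (1 / 2) = 1 / 2 := by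
    have hB : turnedPoint c R ((1 / 2 : ℝ) : UnitAddCircle) = ((R - c : ℝ) : ℂ) := by
      rw [turnedPoint, toCircle_half]; push_cast; ring
    rw [chordStep, tangentAngle, centreAngle, halfAperture, hB, toCircle_half, Complex.norm_real,
      Real.norm_eq_abs, abs_of_pos hpos, div_self hpos.ne', Real.arcsin_one]
    have := Real.pi_ne_zero
    simp
    field_simp
    norm_num
  have h2 : (ponceletLift hc hcR ht) (1 / 2) = 1 / 2 + ((0 : ℤ) : ℝ) := by
    rw [Int.cast_zero, add_zero]; exact h1
  rw [CircleDeg1Lift.translationNumber_of_eq_add_int _ h2, Int.cast_zero]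

/-- The first projection conjugates f on Γ_t to a circle homeomorphism, so exact periods can be read
on the circle. -/
theorem exists_minimalPeriod_ponceletMap_iff (ht : t ∈ Set.Icc 0 (R - c)) {q : ℕ} (hq : 0 < q) :
    (∃ p ∈ tangentFlags c R t, Function.minimalPeriod (ponceletMap c R) p = q) ↔
      ∃ m : ℤ, IsCoprime m (q : ℤ) ∧ ponceletRotation hc hcR t = m / q := by
  have hper : ∀ x, Function.minimalPeriod (ponceletMap c R) (x, tangentDirection c R t x)
      = Function.minimalPeriod (graphMap (ponceletMap c R) (tangentDirection c R t)) x := by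
    intro x
    rw [Function.minimalPeriod_eq_minimalPeriod_iff]
    intro n
    have hs := (semiconj_graphMap hc hcR ht).iterate_right n x
    rw [Function.IsPeriodicPt, Function.IsPeriodicPt, Function.IsFixedPt, Function.IsFixedPt, ← hs]
    exact ⟨fun h => congrArg Prod.fst h, fun h => by rw [h]⟩
  rw [ponceletRotation_eq hc hcR ht,
    ← (isOrientedLift_ponceletLift hc hcR ht).exists_minimalPeriod_eq_iff hq,
    tangentFlags_eq_range hc hcR ht, Set.exists_range_iff]
  simp only [hper]

/-- Both t ↦ Γ_t and the rotation number are injective in t, and the latter takes every value in [0,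
1/2]. Counting circles is therefore counting reduced fractions there. -/
theorem ncard_circlesWithPeriod {q : ℕ} (hq : 0 < q) :
    (circlesWithPeriod c R q).ncard
      = ((Finset.range q).filter fun m => m.Coprime q ∧ 2 * m ≤ q).card := by
  set r := ponceletRotation hc hcR with hr
  set S := {t ∈ Set.Icc 0 (R - c) | ∃ m : ℤ, IsCoprime m (q : ℤ) ∧ r t = m / q} with hS
  have hanti := strictAntiOn_ponceletRotation hc hcR
  have hq0 : (0 : ℝ) < q := by exact_mod_cast hq
  have h1 : circlesWithPeriod c R q = tangentFlags c R '' S := by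
    ext Γ
    constructor
    · rintro ⟨⟨t, ht, rfl⟩, h⟩
      exact ⟨t, ⟨ht, (exists_minimalPeriod_ponceletMap_iff hc hcR ht hq).1 h⟩, rfl⟩
    · rintro ⟨t, ⟨ht, h⟩, rfl⟩
      exact ⟨⟨t, ht, rfl⟩, (exists_minimalPeriod_ponceletMap_iff hc hcR ht hq).2 h⟩
  have hsub : S ⊆ Set.Icc 0 (R - c) := fun t ht => ht.1
  have h2 : r '' S = (fun m : ℕ => (m / q : ℝ)) ''
      ((Finset.range q).filter fun m => m.Coprime q ∧ 2 * m ≤ q : Finset ℕ) := by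
    ext ρ
    simp only [Set.mem_image, Finset.coe_filter, Finset.mem_range, Set.mem_ofPred_eq]
    constructor
    · rintro ⟨t, ⟨ht, m, hm, htm⟩, rfl⟩
      have hle : r t ≤ 1 / 2 := by
        rw [← ponceletRotation_zero hc hcR]
        exact hanti.antitoneOn ⟨le_rfl, ht.1.trans ht.2⟩ ht ht.1
      have hge : 0 ≤ r t := by
        rw [← ponceletRotation_sub hc hcR]
        exact hanti.antitoneOn ht ⟨ht.1.trans ht.2, le_rfl⟩ ht.2
      rw [htm, le_div_iff₀ hq0, zero_mul] at hge
      rw [htm, div_le_div_iff₀ hq0 two_pos] at hle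
      lift m to ℕ using by exact_mod_cast hge
      have hle' : 2 * m ≤ q := by
        have : (m : ℝ) * 2 ≤ 1 * q := by exact_mod_cast hle
        have : m * 2 ≤ 1 * q := by exact_mod_cast this
        omega
      exact ⟨m, ⟨by omega, Nat.isCoprime_iff_coprime.1 hm, hle'⟩, by rw [htm, Int.cast_natCast]⟩
    · rintro ⟨m, ⟨-, hm, hle⟩, rfl⟩
      have hmem : (m / q : ℝ) ∈ Set.Icc (r (R - c)) (r 0) := by
        rw [hr, ponceletRotation_sub, ponceletRotation_zero]
        refine ⟨by positivity, ?_⟩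
        rw [div_le_div_iff₀ hq0 two_pos]
        have : ((2 * m : ℕ) : ℝ) ≤ q := by exact_mod_cast hle
        push_cast at this
        linarith
      obtain ⟨t, ht, htm⟩ := intermediate_value_Icc' (sub_nonneg.2 hcR.le)
        (continuous_ponceletRotation hc hcR).continuousOn hmem
      exact ⟨t, ⟨ht, m, Nat.isCoprime_iff_coprime.2 hm, by rw [hr, htm, Int.cast_natCast]⟩, htm⟩
  have hinj : Function.Injective fun m : ℕ => (m / q : ℝ) := fun a b h => by
    have := (div_left_inj' hq0.ne').1 h
    exact_mod_cast this
  rw [h1, ((injOn_tangentFlags hc hcR).mono hsub).ncard_image,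
    ← (hanti.injOn.mono hsub).ncard_image, ← hr, h2, Set.ncard_image_of_injective _ hinj,
    Set.ncard_coe_finset]

end Rotation

theorem lemma10 (c R : ℝ) (hc : 0 ≤ c) (hcR : c < R) :
    (∀ t ∈ Set.Icc 0 (R - c),
      IsInvariantRotationalCircle (ponceletMap c R) (tangentFlags c R t)) ∧
    (Set.Icc 0 (R - c)).PairwiseDisjoint (tangentFlags c R) ∧
    (∃ r : ℝ → ℝ, ContinuousOn r (Set.Icc 0 (R - c)) ∧ StrictAntiOn r (Set.Icc 0 (R - c)) ∧
      r 0 = 1 / 2 ∧ r (R - c) = 0 ∧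
      ∀ t ∈ Set.Icc 0 (R - c),
        HasRotationNumber (ponceletMap c R) (tangentFlags c R t) ((r t : ℝ) : UnitAddCircle)) ∧
    (∀ q : ℕ, 3 ≤ q → ((circlesWithPeriod c R q).ncard : ℚ) = (Nat.totient q : ℚ) / 2) ∧
    (circlesWithPeriod c R 1).ncard = 1 ∧
    (circlesWithPeriod c R 2).ncard = 1 := by
  refine ⟨fun t ht => isInvariantRotationalCircle_tangentFlags hc hcR ht,
    pairwiseDisjoint_tangentFlags hc hcR,
    ⟨ponceletRotation hc hcR, (continuous_ponceletRotation hc hcR).continuousOn,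
      strictAntiOn_ponceletRotation hc hcR, ponceletRotation_zero hc hcR,
      ponceletRotation_sub hc hcR, fun t ht => ?_⟩, fun q hq => ?_, ?_, ?_⟩
  · exact ⟨tangentDirection c R t, continuous_tangentDirection hc hcR,
      tangentFlags_eq_range hc hcR ht, ponceletLift hc hcR ht,
      isOrientedLift_ponceletLift hc hcR ht, by rw [ponceletRotation_eq hc hcR ht]⟩
  · rw [ncard_circlesWithPeriod hc hcR (by omega), ← two_mul_card_coprime_le_half hq]
    push_cast
    ring
  · rw [ncard_circlesWithPeriod hc hcR one_pos]
    decide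
  · rw [ncard_circlesWithPeriod hc hcR two_pos]
    decide
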